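/- Consider a slotted wireless link. In slot $n$, $a[n]$ packets arrive, where the $a[n]$ are i.i.d. with $\Pr\{a[n]=m\}=\theta_m$, $0\le m\le M$, and mean $\bar a=\sum_m m\theta_m>0$. The channel states $h[n]\in\{1,\dots,W\}$ are i.i.d. (and independent of the arrivals) with $\Pr\{h[n]=w\}=\eta_w$; sending one packet in state $w$ costs power $P_w$, where $P_1>P_2>\dots>P_W>0$. At most one packet is sent per slot: $s[n]\in\{0,1\}$, and the queue evolves as $q[n]=t[n]-s[n]$ with post-arrival queue $t[n]=q[n-1]+a[n]$. A policy is a family $f_{t,w}\in[0,1]$ with $f_{0,w}=0$: given $t[n]=t$ and $h[n]=w$, it sends ($s[n]=1$) with probability $f_{t,w}$ and keeps silent ($s[n]=0$) otherwise. Let $K\in\mathbb N\cup\{\infty\}$ be the buffer capacity. An admissible pair $(f,\pi)$ consists of a policy $f$ and a stationary distribution $\pi$ of the queue length under $f$ such that no overflow occurs (in the steady state $t[n]\le K$ almost surely) and the mean queue length is finite. Its average delay and average power are $$D=\frac1{\bar a}\sum_k k\,\pi_k,\qquad P=\sum_k\pi_k\sum_{w}\eta_wP_w\sum_{m=0}^M\theta_m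 f_{k+m,w}.$$ Let $P_{aver}$ be a power budget such that some admissible pair has power strictly less than $P_{aver}$, and let $(f^*,\pi^*)$ be any optimal solution of the problem of minimizing $D$ over all admissible pairs subject to $P\le P_{aver}$. Then for each channel state $w$ there is an integer threshold $I_w^*$ with $0\le I_w^*\le K$ (finite also when $K=\infty$) such that, in the steady state, whenever $h[n]=w$, the optimal action is $$s^*[n]=\begin{cases}0,& t[n]<I_w^*,\\ 1,& t[n]>I_w^*.\end{cases}$$ That is, for every $t$ with $\Pr\{t[n]=t,\ h[n]=w\}>0$: $f^*_{t,w}=0$ if $t<I_w^*$, and $f^*_{t,w}=1$ if $t>I_w^*$. -/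

import Mathlib

open scoped BigOperators

/-- A single-server wireless link with i.i.d. bounded batch arrivals and an i.i.d. block-fading
channel with `W` states, listed from the worst one to the best one. -/
structure WirelessLink where
  /-- number of channel states -/
  W : ℕ
  /-- upper bound for the number of packets arriving in one slot -/
  M : ℕ
  /-- `θ m = Pr {a[n] = m}` -/
  θ : ℕ → ℝ
  /-- `η w = Pr {h[n] = w}` -/
  η : Fin W → ℝ
  /-- power needed to transmit one packet in channel state `w` -/
  P : Fin W → ℝ
  θ_nonneg : ∀ m, 0 ≤ θ m
  θ_bounded : ∀ m, M < m → θ m = 0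
  θ_sum : ∑ m ∈ Finset.range (M + 1), θ m = 1
  η_nonneg : ∀ w, 0 ≤ η w
  η_sum : ∑ w, η w = 1
  P_pos : ∀ w, 0 < P w
  P_anti : StrictAnti P

namespace WirelessLink

/-- A probabilistic scheduling policy: `f t w` is the probability of transmitting one packet
(`s[n] = 1`) when the post-arrival queue is `t[n] = q[n-1] + a[n] = t` and the channel state is
`h[n] = w`; with probability `1 - f t w` the transmitter keeps silent (`s[n] = 0`). Nothing can be
sent from an empty queue. -/
structure IsPolicy (L : WirelessLink) (f : ℕ → Fin L.W → ℝ) : Prop where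
  nonneg : ∀ t w, 0 ≤ f t w
  le_one : ∀ t w, f t w ≤ 1
  zero : ∀ w, f 0 w = 0

/-- Average arrival rate. -/
noncomputable def arrivalRate (L : WirelessLink) : ℝ :=
  ∑ m ∈ Finset.range (L.M + 1), (m : ℝ) * L.θ m

/-- One-step transition probability `Pr {q[n] = l | q[n-1] = k}` of the queue
`q[n] = q[n-1] + a[n] - s[n]`. -/
noncomputable def transition (L : WirelessLink) (f : ℕ → Fin L.W → ℝ) (k l : ℕ) : ℝ :=
  ∑ m ∈ Finset.range (L.M + 1), L.θ m * ∑ w, L.η w *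
    (f (k + m) w * (if k + m - 1 = l then 1 else 0)
      + (1 - f (k + m) w) * (if k + m = l then 1 else 0))

/-- `π` is a stationary distribution of the queue length under the policy `f`. -/
structure IsStationary (L : WirelessLink) (f : ℕ → Fin L.W → ℝ) (π : ℕ → ℝ) : Prop where
  nonneg : ∀ k, 0 ≤ π k
  sum_one : HasSum π 1
  balance : ∀ l, HasSum (fun k => π k * L.transition f k l) (π l)

/-- In the steady state `π` the post-arrival queue never exceeds the buffer capacity `K`
(`K = ⊤` is an unlimited buffer, for which this always holds). -/
def NoOverflow (L : WirelessLink) (K : ℕ∞) (π : ℕ → ℝ) : Prop :=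
  ∀ k m : ℕ, 0 < π k → 0 < L.θ m → ((k + m : ℕ) : ℕ∞) ≤ K

/-- Average queueing delay: average queue length divided by the arrival rate. -/
noncomputable def delay (L : WirelessLink) (π : ℕ → ℝ) : ℝ :=
  (1 / L.arrivalRate) * ∑' k : ℕ, (k : ℝ) * π k

/-- Average transmission power. -/
noncomputable def power (L : WirelessLink) (f : ℕ → Fin L.W → ℝ) (π : ℕ → ℝ) : ℝ :=
  ∑' k : ℕ, π k * ∑ w, L.η w * L.P w * ∑ m ∈ Finset.range (L.M + 1), L.θ m * f (k + m) w

/-- `f` is a scheduling policy, `π` is a steady state of it without overflow of the buffer, and the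
average queueing delay is finite. -/
structure IsAdmissible (L : WirelessLink) (K : ℕ∞) (f : ℕ → Fin L.W → ℝ) (π : ℕ → ℝ) : Prop where
  policy : L.IsPolicy f
  stationary : L.IsStationary f π
  noOverflow : L.NoOverflow K π
  finite_delay : Summable fun k : ℕ => (k : ℝ) * π k

/-- `(f, π)` solves the problem of minimizing the average queueing delay subject to the average
power constraint `power ≤ Paver`. -/
structure IsOptimal (L : WirelessLink) (K : ℕ∞) (Paver : ℝ) (f : ℕ → Fin L.W → ℝ) (π : ℕ → ℝ) :
    Prop where
  admissible : L.IsAdmissible K f π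
  power_le : L.power f π ≤ Paver
  delay_le : ∀ (f' : ℕ → Fin L.W → ℝ) (π' : ℕ → ℝ), L.IsAdmissible K f' π' →
    L.power f' π' ≤ Paver → L.delay π ≤ L.delay π'

/-- Steady-state probability `Pr {t[n] = t, h[n] = w}` that the post-arrival queue
`t[n] = q[n-1] + a[n]` equals `t` while the channel is in state `w`. -/
noncomputable def stateProb (L : WirelessLink) (π : ℕ → ℝ) (t : ℕ) (w : Fin L.W) : ℝ :=
  L.η w * ∑ k ∈ Finset.range (t + 1), π k * L.θ (t - k)

end WirelessLink

/-! Mean queue length and power are linear in the joint steady-state frequencies of queue, channel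
and action, so the problem is convex. Slater's condition then gives `lam ≥ 0` such that the optimal
pair minimizes mean queue length plus `lam` times power over all admissible pairs
(`IsOptimal.exists_multiplier`). This is an average-cost decision problem. If its relative value
function is `h t = ∑ j < t, d (j + 1)`, then sending from `t` in state `w` saves `d t - lam * P w`;
convexity of `h`, that is, monotonicity of `d`, is what makes thresholds optimal.

For arrival rate below 1, value iteration on the differences `d` produces a monotone solution
(`exists_isMarginalCost`). Averaging the Bellman equation over a steady state shows that the
Lagrangian exceeds a constant, the gain, by the mean of nonnegative losses `max 0 x - f * x` with `x
= d t - lam * P w` (`IsAdmissible.hasSum_loss`). The greedy policy has no loss and possesses an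
admissible steady state (`exists_isAdmissible_greedy`), so the gain is attained. Hence the optimal
pair has zero loss wherever the probability is positive, which forces `f = 0` if `x < 0` and `f = 1`
if `x > 0`. Since `d` is strictly increasing, `x = 0` for at most one `t`.

A finite buffer is encoded by a holding cost that jumps at `K`: no admissible pair ever pays the
surcharge, but it makes the greedy policy always send from `K` on. If the arrival rate is at least
1, flow balance alone forces transmission in every slot. -/

namespace WirelessLink

variable {L : WirelessLink}

/-! ### Post-arrival law, one-step balance and power. -/

/-- Steady-state law of the post-arrival queue. -/
noncomputable def postArrival (L : WirelessLink) (π : ℕ → ℝ) (t : ℕ) : ℝ :=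
  ∑ k ∈ Finset.range (t + 1), π k * L.θ (t - k)

/-- Probability of transmitting from the post-arrival queue `t`, averaged over the channel. -/
noncomputable def sendProb (L : WirelessLink) (f : ℕ → Fin L.W → ℝ) (t : ℕ) : ℝ :=
  ∑ w, L.η w * f t w

/-- Conditional mean of `φ (t[n])` given that the previous queue length is `k`. -/
noncomputable def arrivalMean (L : WirelessLink) (φ : ℕ → ℝ) (k : ℕ) : ℝ :=
  ∑ m ∈ Finset.range (L.M + 1), L.θ m * φ (k + m)

theorem postArrival_eq (L : WirelessLink) (π : ℕ → ℝ) (t : ℕ) :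
    L.postArrival π t =
      ∑ m ∈ Finset.range (L.M + 1), L.θ m * (if m ≤ t then π (t - m) else 0) := by
  have h1 : L.postArrival π t = ∑ m ∈ Finset.range (t + 1), L.θ m * π (t - m) := by
    unfold postArrival
    rw [← Finset.sum_range_reflect]
    refine Finset.sum_congr rfl fun m hm => ?_
    have hm' := Finset.mem_range.1 hm
    rw [show t + 1 - 1 - m = t - m by omega, show t - (t - m) = m by omega, mul_comm]
  have h2 : ∀ N, t + 1 ≤ N → L.M + 1 ≤ N →
      ∑ m ∈ Finset.range N, L.θ m * (if m ≤ t then π (t - m) else 0) = L.postArrival π t ∧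
      ∑ m ∈ Finset.range N, L.θ m * (if m ≤ t then π (t - m) else 0) =
        ∑ m ∈ Finset.range (L.M + 1), L.θ m * (if m ≤ t then π (t - m) else 0) := by
    intro N h3 h4
    constructor
    · rw [h1]
      symm
      rw [← Finset.sum_subset (Finset.range_mono h3)]
      · refine Finset.sum_congr rfl fun m hm => ?_
        rw [if_pos (by have := Finset.mem_range.1 hm; omega)]
      · intro m _ hm
        rw [if_neg (by simpa using hm), mul_zero]
    · symm
      refine Finset.sum_subset (Finset.range_mono h4) fun m _ hm => ?_
      rw [L.θ_bounded m (by simpa using hm), zero_mul]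
  obtain ⟨h5, h6⟩ := h2 (t + 1 + (L.M + 1)) (by omega) (by omega)
  rw [← h5, h6]

/-- Two ways of computing the mean of `φ (t[n])`. Only finitely many batch sizes occur, so
summability of each shift suffices for the exchange of sums. -/
theorem hasSum_postArrival_mul {π φ : ℕ → ℝ} (hs : ∀ m, Summable fun k => π k * φ (k + m)) :
    HasSum (fun k => π k * L.arrivalMean φ k) (∑' t, L.postArrival π t * φ t) ∧
    Summable (fun t => L.postArrival π t * φ t) := by
  have h1 : HasSum (fun k => π k * L.arrivalMean φ k)
      (∑ m ∈ Finset.range (L.M + 1), L.θ m * ∑' k, π k * φ (k + m)) := by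
    have := hasSum_sum (s := Finset.range (L.M + 1))
      (f := fun m k => L.θ m * (π k * φ (k + m))) fun m _ => (hs m).hasSum.mul_left (L.θ m)
    refine this.congr_fun ?_
    intro k
    rw [arrivalMean, Finset.mul_sum]
    exact Finset.sum_congr rfl fun m _ => by ring
  have h2 : HasSum (fun t => L.postArrival π t * φ t)
      (∑ m ∈ Finset.range (L.M + 1), L.θ m * ∑' k, π k * φ (k + m)) := by
    have h3 : ∀ m, HasSum (fun t => if m ≤ t then π (t - m) * φ t else 0)
        (∑' k, π k * φ (k + m)) := by
      intro m
      rw [← (add_left_injective m).hasSum_iff]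
      · convert (hs m).hasSum using 2 with k
        simp
      · intro t ht
        rw [if_neg]
        intro h
        exact ht ⟨t - m, by simp [h]⟩
    have := hasSum_sum (s := Finset.range (L.M + 1)) fun m _ => (h3 m).mul_left (L.θ m)
    refine this.congr_fun ?_
    intro t
    rw [postArrival_eq, Finset.sum_mul]
    refine Finset.sum_congr rfl fun m _ => ?_
    split_ifs <;> ring
  exact ⟨h2.tsum_eq ▸ h1, h2.summable⟩

theorem sendProb_nonneg {f : ℕ → Fin L.W → ℝ} (hf : L.IsPolicy f) (t : ℕ) : 0 ≤ L.sendProb f t :=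
  Finset.sum_nonneg fun w _ => mul_nonneg (L.η_nonneg w) (hf.nonneg t w)

theorem sendProb_le_one {f : ℕ → Fin L.W → ℝ} (hf : L.IsPolicy f) (t : ℕ) :
    L.sendProb f t ≤ 1 := by
  rw [← L.η_sum]
  exact Finset.sum_le_sum fun w _ => mul_le_of_le_one_right (L.η_nonneg w) (hf.le_one t w)

theorem sendProb_zero {f : ℕ → Fin L.W → ℝ} (hf : L.IsPolicy f) : L.sendProb f 0 = 0 := by
  simp [sendProb, hf.zero]

theorem postArrival_nonneg {π : ℕ → ℝ} (hπ : ∀ k, 0 ≤ π k) (t : ℕ) : 0 ≤ L.postArrival π t :=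
  Finset.sum_nonneg fun k _ => mul_nonneg (hπ k) (L.θ_nonneg _)

/-- One step of the queue-length law, expressed through the post-arrival law. -/
noncomputable def step (L : WirelessLink) (f : ℕ → Fin L.W → ℝ) (π : ℕ → ℝ) (l : ℕ) : ℝ :=
  L.postArrival π (l + 1) * L.sendProb f (l + 1) + L.postArrival π l * (1 - L.sendProb f l)

/-- A queue of length `l` arises only from a departure at `l + 1` or silence at `l`. The truncated
`0 - 1 = 0` is harmless because nothing is sent from `0`. Balance thus becomes a finite expression
in `π`. -/
theorem hasSum_transition {f : ℕ → Fin L.W → ℝ} (hf : L.IsPolicy f) (π : ℕ → ℝ) (l : ℕ) :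
    HasSum (fun k => π k * L.transition f k l) (L.step f π l) := by
  set φ : ℕ → ℝ := fun t => ∑ w, L.η w *
    (f t w * (if t - 1 = l then 1 else 0) + (1 - f t w) * (if t = l then 1 else 0)) with hφ
  have hφ0 : ∀ t, t ≠ l → t ≠ l + 1 → φ t = 0 := by
    intro t h1 h2
    refine Finset.sum_eq_zero fun w _ => ?_
    rw [if_neg h1, mul_zero, add_zero]
    by_cases h3 : t - 1 = l
    · have : t = 0 := by omega
      simp [this, hf.zero]
    · simp [h3]
  have hφ1 : φ (l + 1) = L.sendProb f (l + 1) := by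
    simp [hφ, sendProb]
  have hφ2 : φ l = 1 - L.sendProb f l := by
    rw [sendProb, ← L.η_sum, ← Finset.sum_sub_distrib]
    refine Finset.sum_congr rfl fun w _ => ?_
    rcases Nat.eq_zero_or_pos l with h | h
    · subst h; simp [hf.zero]
    · rw [if_neg (by omega), if_pos rfl]; ring
  have hs : ∀ m, Summable fun k => π k * φ (k + m) := by
    intro m
    refine summable_of_ne_finset_zero (s := Finset.range (l + 2)) fun k hk => ?_
    have : l + 2 ≤ k := by simpa using hk
    rw [hφ0 _ (by omega) (by omega), mul_zero]
  have h1 := (hasSum_postArrival_mul (L := L) hs).1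
  have h2 : ∑' t, L.postArrival π t * φ t = L.step f π l := by
    rw [tsum_eq_sum (s := {l, l + 1})]
    · rw [Finset.sum_pair (by omega), hφ1, hφ2, step, add_comm]
    · intro t ht
      simp only [Finset.mem_insert, Finset.mem_singleton, not_or] at ht
      rw [hφ0 t ht.1 ht.2, mul_zero]
  rw [h2] at h1
  exact h1

theorem IsStationary.eq_step {f : ℕ → Fin L.W → ℝ} (hf : L.IsPolicy f) {π : ℕ → ℝ}
    (h : L.IsStationary f π) (l : ℕ) : π l = L.step f π l :=
  (h.balance l).unique (hasSum_transition hf π l)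

theorem summable_mul_of_le {π φ : ℕ → ℝ} (hπ : ∀ k, 0 ≤ π k) (h0 : Summable π)
    (h1 : Summable fun k : ℕ => (k : ℝ) * π k) {B : ℝ} (hφ : ∀ t : ℕ, |φ t| ≤ B * (1 + t)) :
    Summable fun k => π k * φ k := by
  refine Summable.of_norm_bounded ((h0.add h1).mul_left B) fun k => ?_
  rw [Real.norm_eq_abs, abs_mul, abs_of_nonneg (hπ k)]
  nlinarith [mul_le_mul_of_nonneg_left (hφ k) (hπ k)]

theorem summable_mul_shift_of_le {π φ : ℕ → ℝ} (hπ : ∀ k, 0 ≤ π k) (h0 : Summable π)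
    (h1 : Summable fun k : ℕ => (k : ℝ) * π k) {B : ℝ} (hφ : ∀ t : ℕ, |φ t| ≤ B * (1 + t))
    (m : ℕ) : Summable fun k => π k * φ (k + m) := by
  have hB : 0 ≤ B := by simpa using (abs_nonneg _).trans (hφ 0)
  refine summable_mul_of_le (φ := fun k => φ (k + m)) hπ h0 h1 (B := B * (1 + m)) fun t => ?_
  refine (hφ _).trans ?_
  push_cast
  rw [mul_assoc]
  refine mul_le_mul_of_nonneg_left ?_ hB
  nlinarith [mul_nonneg (Nat.cast_nonneg (α := ℝ) t) (Nat.cast_nonneg (α := ℝ) m)]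

theorem arrivalMean_const (c : ℝ) (k : ℕ) : L.arrivalMean (fun _ => c) k = c := by
  simp only [arrivalMean]
  rw [← Finset.sum_mul, L.θ_sum, one_mul]

theorem arrivalMean_mono {φ ψ : ℕ → ℝ} (h : ∀ t, φ t ≤ ψ t) (k : ℕ) :
    L.arrivalMean φ k ≤ L.arrivalMean ψ k :=
  Finset.sum_le_sum fun m _ => mul_le_mul_of_nonneg_left (h _) (L.θ_nonneg m)

theorem arrivalMean_add (φ ψ : ℕ → ℝ) (k : ℕ) :
    L.arrivalMean (fun t => φ t + ψ t) k = L.arrivalMean φ k + L.arrivalMean ψ k := by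
  simp only [arrivalMean, ← Finset.sum_add_distrib, mul_add]

theorem arrivalMean_sub (φ ψ : ℕ → ℝ) (k : ℕ) :
    L.arrivalMean (fun t => φ t - ψ t) k = L.arrivalMean φ k - L.arrivalMean ψ k := by
  simp only [arrivalMean, ← Finset.sum_sub_distrib, mul_sub]

theorem arrivalMean_natCast (k : ℕ) :
    L.arrivalMean (fun t => (t : ℝ)) k = k + L.arrivalRate := by
  simp only [arrivalMean, arrivalRate, Nat.cast_add, mul_add, Finset.sum_add_distrib]
  rw [← Finset.sum_mul, L.θ_sum, one_mul]
  congr 1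
  exact Finset.sum_congr rfl fun m _ => mul_comm _ _

theorem power_eq {f : ℕ → Fin L.W → ℝ} (hf : L.IsPolicy f) {π : ℕ → ℝ} (hπ : ∀ k, 0 ≤ π k)
    (h0 : Summable π) :
    L.power f π = ∑' t, L.postArrival π t * ∑ w, L.η w * L.P w * f t w ∧
      Summable (fun t => L.postArrival π t * ∑ w, L.η w * L.P w * f t w) := by
  set φ : ℕ → ℝ := fun t => ∑ w, L.η w * L.P w * f t w with hφ
  have hs : ∀ m, Summable fun k => π k * φ (k + m) := by
    intro m
    refine Summable.of_norm_bounded (h0.mul_right (∑ w, L.η w * L.P w)) fun k => ?_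
    have hη : ∀ w, 0 ≤ L.η w * L.P w := fun w => mul_nonneg (L.η_nonneg w) (L.P_pos w).le
    rw [Real.norm_eq_abs, abs_of_nonneg]
    · exact mul_le_mul_of_nonneg_left (Finset.sum_le_sum fun w _ =>
        mul_le_of_le_one_right (hη w) (hf.le_one _ w)) (hπ k)
    · exact mul_nonneg (hπ k) (Finset.sum_nonneg fun w _ => mul_nonneg (hη w) (hf.nonneg _ w))
  have h := hasSum_postArrival_mul (L := L) (π := π) (φ := φ) hs
  refine ⟨?_, h.2⟩
  rw [← h.1.tsum_eq, power]
  refine tsum_congr fun k => ?_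
  simp only [arrivalMean, hφ, Finset.mul_sum]
  rw [Finset.sum_comm]
  refine Finset.sum_congr rfl fun m _ => Finset.sum_congr rfl fun w _ => ?_
  ring

/-! ### Convexity and the Lagrange multiplier. -/

/-- Lagrange multiplier for a convex problem in the plane under Slater's condition. -/
theorem exists_multiplier {S : Set (ℝ × ℝ)} (hS : Convex ℝ S) {a b : ℝ}
    (hslater : ∃ z ∈ S, z.2 < b) (hopt : ∀ z ∈ S, z.2 ≤ b → a ≤ z.1) :
    ∃ lam : ℝ, 0 ≤ lam ∧ ∀ z ∈ S, a + lam * b ≤ z.1 + lam * z.2 := by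
  obtain ⟨z₀, hz₀, hb₀⟩ := hslater
  -- The segment from `u` to `v` meets the line of second coordinate `b` at a point of `S`, whose
  -- first coordinate is at least `a`. This separates the slopes on the two sides.
  have key : ∀ u ∈ S, u.2 < b → ∀ v ∈ S, b < v.2 →
      (a - v.1) / (v.2 - b) ≤ (u.1 - a) / (b - u.2) := by
    intro u hu hub v hv hvb
    have hd : 0 < v.2 - u.2 := by linarith
    have hmem := hS hu hv (a := (v.2 - b) / (v.2 - u.2)) (b := (b - u.2) / (v.2 - u.2))
      (div_nonneg (by linarith) hd.le) (div_nonneg (by linarith) hd.le) (by field_simp; ring)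
    have h2 := hopt _ hmem (le_of_eq (by simp; field_simp; ring))
    simp only [Prod.fst_add, Prod.smul_fst, smul_eq_mul] at h2
    rw [div_mul_eq_mul_div, div_mul_eq_mul_div, ← add_div, le_div_iff₀ hd] at h2
    rw [div_le_div_iff₀ (by linarith) (by linarith)]
    nlinarith
  -- The multiplier is the supremum of the slopes from the infeasible side; inserting `0` makes it
  -- nonnegative and `A` nonempty, and Slater's point bounds `A`.
  set A : Set ℝ := insert 0 {x | ∃ v ∈ S, b < v.2 ∧ x = (a - v.1) / (v.2 - b)} with hA
  have hub : ∀ u ∈ S, u.2 < b → (u.1 - a) / (b - u.2) ∈ upperBounds A := by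
    intro u hu h x hx
    rcases hx with rfl | ⟨v, hv, hvb, rfl⟩
    · exact div_nonneg (by linarith [hopt u hu h.le]) (by linarith)
    · exact key u hu h v hv hvb
  have hbdd : BddAbove A := ⟨_, hub z₀ hz₀ hb₀⟩
  refine ⟨sSup A, le_csSup hbdd (Set.mem_insert _ _), fun z hz => ?_⟩
  rcases lt_trichotomy z.2 b with h | h | h
  · have h1 : sSup A ≤ _ := csSup_le ⟨0, Set.mem_insert _ _⟩ (hub z hz h)
    rw [le_div_iff₀ (by linarith)] at h1
    linarith
  · rw [h]
    linarith [hopt z hz h.le]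
  · have h1 : _ ≤ sSup A := le_csSup hbdd (Set.mem_insert_of_mem _ ⟨z, hz, h, rfl⟩)
    rw [div_le_iff₀ (by linarith)] at h1
    linarith

/-- Balance and power are linear in `π` and in the products of post-arrival law and policy. Mixing
both linearly, the policy is recovered as a conditional probability; where the mixed law vanishes
its value `0 / 0 = 0` is irrelevant. -/
theorem IsAdmissible.exists_mix {K : ℕ∞} {f₁ f₂ : ℕ → Fin L.W → ℝ} {π₁ π₂ : ℕ → ℝ}
    (h₁ : L.IsAdmissible K f₁ π₁) (h₂ : L.IsAdmissible K f₂ π₂) {a b : ℝ} (ha : 0 ≤ a)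
    (hb : 0 ≤ b) (hab : a + b = 1) :
    ∃ f π, L.IsAdmissible K f π ∧
      ∑' k : ℕ, (k : ℝ) * π k = a * ∑' k : ℕ, (k : ℝ) * π₁ k + b * ∑' k : ℕ, (k : ℝ) * π₂ k ∧
      L.power f π = a * L.power f₁ π₁ + b * L.power f₂ π₂ := by
  set π : ℕ → ℝ := fun k => a * π₁ k + b * π₂ k with hπ
  set y₁ := L.postArrival π₁
  set y₂ := L.postArrival π₂
  have hy₁ : ∀ t, 0 ≤ y₁ t := postArrival_nonneg h₁.stationary.nonneg
  have hy₂ : ∀ t, 0 ≤ y₂ t := postArrival_nonneg h₂.stationary.nonneg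
  have hy : ∀ t, L.postArrival π t = a * y₁ t + b * y₂ t := by
    intro t
    simp only [postArrival, y₁, y₂, hπ, Finset.mul_sum, ← Finset.sum_add_distrib]
    exact Finset.sum_congr rfl fun _ _ => by ring
  set f : ℕ → Fin L.W → ℝ := fun t w =>
    (a * y₁ t * f₁ t w + b * y₂ t * f₂ t w) / (a * y₁ t + b * y₂ t) with hf
  have hay : ∀ t, 0 ≤ a * y₁ t := fun t => mul_nonneg ha (hy₁ t)
  have hby : ∀ t, 0 ≤ b * y₂ t := fun t => mul_nonneg hb (hy₂ t)
  have hyf : ∀ t w, L.postArrival π t * f t w = a * y₁ t * f₁ t w + b * y₂ t * f₂ t w := by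
    intro t w
    rw [hy]
    by_cases h : a * y₁ t + b * y₂ t = 0
    · have h1 : a * y₁ t = 0 := by linarith [hay t, hby t]
      have h2 : b * y₂ t = 0 := by linarith [hay t, hby t]
      simp [h1, h2]
    · simp only [hf]
      field_simp
  have hpol : L.IsPolicy f := by
    refine ⟨fun t w => ?_, fun t w => ?_, fun w => ?_⟩
    · exact div_nonneg (add_nonneg (mul_nonneg (hay t) (h₁.policy.nonneg t w))
        (mul_nonneg (hby t) (h₂.policy.nonneg t w))) (add_nonneg (hay t) (hby t))
    · refine div_le_one_of_le₀ ?_ (add_nonneg (hay t) (hby t))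
      exact add_le_add (mul_le_of_le_one_right (hay t) (h₁.policy.le_one t w))
        (mul_le_of_le_one_right (hby t) (h₂.policy.le_one t w))
    · simp [hf, h₁.policy.zero, h₂.policy.zero]
  have hyg : ∀ (c : Fin L.W → ℝ) t, L.postArrival π t * ∑ w, c w * f t w =
      a * (y₁ t * ∑ w, c w * f₁ t w) + b * (y₂ t * ∑ w, c w * f₂ t w) := by
    intro c t
    simp only [Finset.mul_sum, ← Finset.sum_add_distrib]
    refine Finset.sum_congr rfl fun w _ => ?_
    rw [mul_left_comm, hyf]
    ring
  have hstep : ∀ l, L.step f π l = π l := by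
    intro l
    have e1 := h₁.stationary.eq_step h₁.policy l
    have e2 := h₂.stationary.eq_step h₂.policy l
    simp only [step, sendProb, mul_sub, mul_one] at e1 e2 ⊢
    rw [hyg, hyg, hy]
    simp only [hπ]
    rw [e1, e2]
    ring
  have hsum : HasSum π 1 := by
    have := (h₁.stationary.sum_one.mul_left a).add (h₂.stationary.sum_one.mul_left b)
    rwa [mul_one, mul_one, hab] at this
  have hnn : ∀ k, 0 ≤ π k := fun k => add_nonneg (mul_nonneg ha (h₁.stationary.nonneg k))
    (mul_nonneg hb (h₂.stationary.nonneg k))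
  have hmean : HasSum (fun k : ℕ => (k : ℝ) * π k)
      (a * ∑' k : ℕ, (k : ℝ) * π₁ k + b * ∑' k : ℕ, (k : ℝ) * π₂ k) := by
    refine ((h₁.finite_delay.hasSum.mul_left a).add (h₂.finite_delay.hasSum.mul_left b)).congr_fun
      fun k => ?_
    simp only [hπ]
    ring
  refine ⟨f, π, ⟨hpol, ⟨hnn, hsum, fun l => ?_⟩, fun k m hk hm => ?_, hmean.summable⟩,
    hmean.tsum_eq, ?_⟩
  · have := hasSum_transition hpol π l
    rwa [hstep] at this
  · rcases (h₁.stationary.nonneg k).eq_or_lt with h | h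
    · rcases (h₂.stationary.nonneg k).eq_or_lt with h' | h'
      · simp [hπ, ← h, ← h'] at hk
      · exact h₂.noOverflow k m h' hm
    · exact h₁.noOverflow k m h hm
  · obtain ⟨e1, s1⟩ := power_eq h₁.policy h₁.stationary.nonneg h₁.stationary.sum_one.summable
    obtain ⟨e2, s2⟩ := power_eq h₂.policy h₂.stationary.nonneg h₂.stationary.sum_one.summable
    rw [(power_eq hpol hnn hsum.summable).1, e1, e2, ← tsum_mul_left, ← tsum_mul_left,
      ← (s1.mul_left a).tsum_add (s2.mul_left b)]
    exact tsum_congr fun t => hyg _ t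

theorem IsOptimal.exists_multiplier (hrate : 0 < L.arrivalRate) {K : ℕ∞} {Paver : ℝ}
    (hslack : ∃ (f₀ : ℕ → Fin L.W → ℝ) (π₀ : ℕ → ℝ),
      L.IsAdmissible K f₀ π₀ ∧ L.power f₀ π₀ < Paver)
    {f : ℕ → Fin L.W → ℝ} {π : ℕ → ℝ} (hopt : L.IsOptimal K Paver f π) :
    ∃ lam : ℝ, 0 ≤ lam ∧ ∀ f' π', L.IsAdmissible K f' π' →
      ∑' k : ℕ, (k : ℝ) * π k + lam * L.power f π ≤
        ∑' k : ℕ, (k : ℝ) * π' k + lam * L.power f' π' := by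
  set S : Set (ℝ × ℝ) := {z | ∃ f' π', L.IsAdmissible K f' π' ∧
    z = (∑' k : ℕ, (k : ℝ) * π' k, L.power f' π')} with hSdef
  have hS : Convex ℝ S := by
    rintro _ ⟨f₁, π₁, h₁, rfl⟩ _ ⟨f₂, π₂, h₂, rfl⟩ a b ha hb hab
    obtain ⟨g, ρ, hg, e1, e2⟩ := h₁.exists_mix h₂ ha hb hab
    refine ⟨g, ρ, hg, ?_⟩
    rw [e1, e2]
    simp
  have hslater : ∃ z ∈ S, z.2 < Paver := by
    obtain ⟨f₀, π₀, h1, h2⟩ := hslack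
    exact ⟨_, ⟨f₀, π₀, h1, rfl⟩, h2⟩
  have hmin : ∀ z ∈ S, z.2 ≤ Paver → ∑' k : ℕ, (k : ℝ) * π k ≤ z.1 := by
    rintro _ ⟨f', π', h', rfl⟩ hle
    have := hopt.delay_le f' π' h' hle
    rwa [delay, delay, mul_le_mul_iff_of_pos_left (one_div_pos.2 hrate)] at this
  obtain ⟨lam, h0, h⟩ := WirelessLink.exists_multiplier hS hslater hmin
  refine ⟨lam, h0, fun f' π' h' => le_trans ?_ (h _ ⟨f', π', h', rfl⟩)⟩
  -- The multiplier bound has the budget on its left side; the optimal power is no larger.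
  linarith [mul_le_mul_of_nonneg_left hopt.power_le h0]

/-! ### Drift identities in steady state. -/

theorem arrivalMean_shift_sub (h : ℕ → ℝ) (k : ℕ) :
    L.arrivalMean h k - h k = ∑ m ∈ Finset.range (L.M + 1), L.θ m * (h (k + m) - h k) := by
  simp only [arrivalMean, mul_sub, Finset.sum_sub_distrib]
  rw [← Finset.sum_mul, L.θ_sum, one_mul]

/-- In steady state the drift due to arrivals balances the drift due to departures, for a bounded
potential. -/
theorem tsum_drift_of_bounded {f : ℕ → Fin L.W → ℝ} (hf : L.IsPolicy f) {π : ℕ → ℝ}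
    (hπ : L.IsStationary f π) {h : ℕ → ℝ} {B : ℝ} (hB : ∀ t, |h t| ≤ B) (h0 : h 0 = 0) :
    ∑' k, π k * (L.arrivalMean h k - h k) =
      ∑' t, L.postArrival π (t + 1) * L.sendProb f (t + 1) * (h (t + 1) - h t) := by
  have hnn := hπ.nonneg
  have hsp : ∀ (φ : ℕ → ℝ), (∀ t, |φ t| ≤ B) → Summable fun k => π k * φ k := by
    intro φ hφ
    refine Summable.of_norm_bounded (hπ.sum_one.summable.mul_right B) fun k => ?_
    rw [Real.norm_eq_abs, abs_mul, abs_of_nonneg (hnn k)]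
    exact mul_le_mul_of_nonneg_left (hφ k) (hnn k)
  obtain ⟨e1, s1⟩ := hasSum_postArrival_mul (L := L) (π := π) (φ := h)
    fun m => hsp _ fun t => hB _
  have hy := postArrival_nonneg (L := L) hnn
  have hu : Summable fun t => L.postArrival π t * L.sendProb f t * h t := by
    refine Summable.of_norm_bounded s1.norm fun t => ?_
    simp only [Real.norm_eq_abs, abs_mul]
    rw [abs_of_nonneg (sendProb_nonneg hf t)]
    exact mul_le_mul_of_nonneg_right
      (mul_le_of_le_one_right (abs_nonneg _) (sendProb_le_one hf t)) (abs_nonneg _)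
  have hy1 : Summable (L.postArrival π) := by
    have := (hasSum_postArrival_mul (L := L) (π := π) (φ := fun _ => 1)
      fun m => by simpa using hπ.sum_one.summable).2
    simpa using this
  have hu' : Summable fun t => L.postArrival π (t + 1) * L.sendProb f (t + 1) * h t := by
    refine Summable.of_norm_bounded (((summable_nat_add_iff 1).2 hy1).mul_right B) fun t => ?_
    simp only [Real.norm_eq_abs, abs_mul]
    rw [abs_of_nonneg (sendProb_nonneg hf _), abs_of_nonneg (hy _)]
    exact mul_le_mul (mul_le_of_le_one_right (hy _) (sendProb_le_one hf _)) (hB t)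
      (abs_nonneg _) (hy _)
  -- Stationarity: the mean of `h` is unchanged by one slot.
  have e2 : ∑' k, π k * h k = ∑' t, L.postArrival π (t + 1) * L.sendProb f (t + 1) * h t
      + (∑' t, L.postArrival π t * h t - ∑' t, L.postArrival π t * L.sendProb f t * h t) := by
    rw [← s1.tsum_sub hu, ← hu'.tsum_add (s1.sub hu)]
    refine tsum_congr fun l => ?_
    rw [hπ.eq_step hf l, step]
    ring
  have e3 : ∑' t, L.postArrival π t * L.sendProb f t * h t =
      ∑' t, L.postArrival π (t + 1) * L.sendProb f (t + 1) * h (t + 1) := by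
    rw [hu.tsum_eq_zero_add, h0, mul_zero, zero_add]
  have e4 : ∑' t, L.postArrival π (t + 1) * L.sendProb f (t + 1) * (h (t + 1) - h t) =
      ∑' t, L.postArrival π (t + 1) * L.sendProb f (t + 1) * h (t + 1) -
      ∑' t, L.postArrival π (t + 1) * L.sendProb f (t + 1) * h t := by
    rw [← ((summable_nat_add_iff 1).2 hu).tsum_sub hu']
    exact tsum_congr fun t => by ring
  have e5 : ∑' k, π k * (L.arrivalMean h k - h k) =
      ∑' k, π k * L.arrivalMean h k - ∑' k, π k * h k := by
    rw [← e1.summable.tsum_sub (hsp h hB)]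
    exact tsum_congr fun t => by ring
  rw [e5, e4, e1.tsum_eq, e2, e3]
  ring

/-- In steady state the drift due to arrivals balances the drift due to departures, for a potential
with increments of linear growth. -/
theorem IsAdmissible.tsum_drift {K : ℕ∞} {f : ℕ → Fin L.W → ℝ} {π : ℕ → ℝ}
    (ha : L.IsAdmissible K f π) {d : ℕ → ℝ} {B : ℝ} (hd : ∀ t, 0 ≤ d t)
    (hB : ∀ t : ℕ, d t ≤ B * (1 + t)) {h : ℕ → ℝ}
    (hh : ∀ t, h t = ∑ j ∈ Finset.range t, d (j + 1)) :
    Summable (fun k => π k * (L.arrivalMean h k - h k)) ∧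
    Summable (fun t => L.postArrival π t * (L.sendProb f t * d t)) ∧
    ∑' k, π k * (L.arrivalMean h k - h k) =
      ∑' t, L.postArrival π t * (L.sendProb f t * d t) := by
  have hst := ha.stationary
  have hnn := hst.nonneg
  have hy := postArrival_nonneg (L := L) hnn
  have hB0 : 0 ≤ B := by simpa using (hd 0).trans (hB 0)
  have hF0 := sendProb_nonneg ha.policy
  have hu : Summable (fun t => L.postArrival π t * (L.sendProb f t * d t)) := by
    have s := (hasSum_postArrival_mul (L := L) (summable_mul_shift_of_le hnn
      hst.sum_one.summable ha.finite_delay (φ := d) (B := B)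
      fun t => by rw [abs_of_nonneg (hd t)]; exact hB t)).2
    refine Summable.of_nonneg_of_le
      (fun t => mul_nonneg (hy t) (mul_nonneg (hF0 t) (hd t))) (fun t => ?_) s
    exact mul_le_mul_of_nonneg_left
      (mul_le_of_le_one_left (hd t) (sendProb_le_one ha.policy t)) (hy t)
  -- `h` may grow quadratically while only the first moment of `π` is finite, so its own mean may
  -- diverge. The potential frozen beyond `N` is bounded, and its increments are dominated by those
  -- of `h`, which grow linearly; dominated convergence then passes to the limit.
  set hN : ℕ → ℕ → ℝ := fun N t => ∑ j ∈ Finset.range t, if j < N then d (j + 1) else 0 with hhN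
  have hterm : ∀ N j, 0 ≤ (if j < N then d (j + 1) else 0 : ℝ) := by
    intro N j; split_ifs; exacts [hd _, le_rfl]
  have hdiff : ∀ N k m, hN N (k + m) - hN N k =
      ∑ j ∈ Finset.range m, if k + j < N then d (k + j + 1) else 0 := by
    intro N k m
    simp only [hhN, Finset.sum_range_add]
    ring
  have hdiff0 : ∀ N k m, 0 ≤ hN N (k + m) - hN N k := by
    intro N k m
    rw [hdiff]
    exact Finset.sum_nonneg fun j _ => hterm N _
  have hdiff1 : ∀ k m, h (k + m) - h k = ∑ j ∈ Finset.range m, d (k + j + 1) := by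
    intro k m
    simp only [hh, Finset.sum_range_add]
    ring
  have hle : ∀ N k m, hN N (k + m) - hN N k ≤ h (k + m) - h k := by
    intro N k m
    rw [hdiff, hdiff1]
    refine Finset.sum_le_sum fun j _ => ?_
    split_ifs
    exacts [le_rfl, hd _]
  have hgrow : ∀ k m : ℕ, h (k + m) - h k ≤ m * (B * (1 + m) * (1 + k)) := by
    intro k m
    rw [hdiff1]
    calc _ ≤ ∑ j ∈ Finset.range m, B * (1 + m) * (1 + k) := by
          refine Finset.sum_le_sum fun j hj => (hB _).trans ?_
          have hj' : (j : ℝ) + 1 ≤ m := by exact_mod_cast Finset.mem_range.1 hj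
          push_cast
          rw [mul_assoc]
          refine mul_le_mul_of_nonneg_left ?_ hB0
          nlinarith [mul_nonneg (Nat.cast_nonneg (α := ℝ) m) (Nat.cast_nonneg (α := ℝ) k)]
      _ = _ := by simp
  have hs : Summable (fun k => π k * (L.arrivalMean h k - h k)) := by
    refine summable_mul_of_le hnn hst.sum_one.summable ha.finite_delay
      (B := ∑ m ∈ Finset.range (L.M + 1), L.θ m * (m * (B * (1 + m)))) fun k => ?_
    rw [arrivalMean_shift_sub, Finset.sum_mul, abs_of_nonneg]
    · refine Finset.sum_le_sum fun m _ => ?_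
      rw [mul_assoc]
      refine mul_le_mul_of_nonneg_left ((hgrow k m).trans (le_of_eq ?_)) (L.θ_nonneg m)
      ring
    · exact Finset.sum_nonneg fun m _ =>
        mul_nonneg (L.θ_nonneg m) ((hdiff0 0 k m).trans (hle 0 k m))
  refine ⟨hs, hu, ?_⟩
  have hbdd : ∀ N t, |hN N t| ≤ ∑ j ∈ Finset.range N, d (j + 1) := by
    intro N t
    rw [abs_of_nonneg (Finset.sum_nonneg fun j _ => hterm N j), ← Finset.sum_filter]
    exact Finset.sum_le_sum_of_subset_of_nonneg
      (fun j hj => Finset.mem_range.2 (Finset.mem_filter.1 hj).2) fun j _ _ => hd _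
  have hid : ∀ N, ∑' k, π k * (L.arrivalMean (hN N) k - hN N k) =
      ∑ t ∈ Finset.range N, L.postArrival π (t + 1) * (L.sendProb f (t + 1) * d (t + 1)) := by
    intro N
    rw [tsum_drift_of_bounded ha.policy hst (hbdd N) (by simp [hhN]),
      tsum_eq_sum (s := Finset.range N)]
    · refine Finset.sum_congr rfl fun t ht => ?_
      simp only [hhN, Finset.sum_range_succ]
      rw [if_pos (Finset.mem_range.1 ht)]
      ring
    · intro t ht
      simp only [hhN, Finset.sum_range_succ]
      rw [if_neg (by simpa using ht)]
      ring
  have hlim1 : Filter.Tendsto (fun N => ∑' k, π k * (L.arrivalMean (hN N) k - hN N k))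
      Filter.atTop (nhds (∑' k, π k * (L.arrivalMean h k - h k))) := by
    refine tendsto_tsum_of_dominated_convergence hs (fun k => ?_) ?_
    · refine tendsto_const_nhds.congr' ?_
      filter_upwards [Filter.eventually_ge_atTop (k + L.M + 1)] with N hNk
      rw [arrivalMean_shift_sub, arrivalMean_shift_sub]
      congr 1
      refine Finset.sum_congr rfl fun m hm => ?_
      rw [hdiff, hdiff1]
      congr 1
      refine Finset.sum_congr rfl fun j hj => ?_
      have := Finset.mem_range.1 hm
      have := Finset.mem_range.1 hj
      rw [if_pos (by omega)]
    · refine Filter.Eventually.of_forall fun N k => ?_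
      rw [arrivalMean_shift_sub, arrivalMean_shift_sub, Real.norm_eq_abs, abs_of_nonneg]
      · exact mul_le_mul_of_nonneg_left (Finset.sum_le_sum fun m _ =>
          mul_le_mul_of_nonneg_left (hle N k m) (L.θ_nonneg m)) (hnn k)
      · exact mul_nonneg (hnn k) (Finset.sum_nonneg fun m _ =>
          mul_nonneg (L.θ_nonneg m) (hdiff0 N k m))
  have hlim2 := ((summable_nat_add_iff 1).2 hu).hasSum.tendsto_sum_nat
  simp only [hid] at hlim1
  rw [tendsto_nhds_unique hlim1 hlim2, hu.tsum_eq_zero_add, sendProb_zero ha.policy]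
  ring

/-! ### Marginal costs and the Bellman equation. -/

/-- `d q` is the marginal cost of the `q`-th packet in the queue, when an additional packet costs
`r q` per slot and a transmission in channel state `w` costs `c w`. -/
structure IsMarginalCost (L : WirelessLink) (c : Fin L.W → ℝ) (r d : ℕ → ℝ) : Prop where
  zero : d 0 = 0
  succ : ∀ q, d (q + 1) = r (q + 1) +
    L.arrivalMean (fun t => ∑ w, L.η w * max (d t) (min (c w) (d (t + 1)))) q
  mono : Monotone d
  bound : ∃ B : ℝ, ∀ t : ℕ, d t ≤ B * (1 + t)

theorem channelMean_mono {φ ψ : Fin L.W → ℝ} (h : ∀ w, φ w ≤ ψ w) :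
    ∑ w, L.η w * φ w ≤ ∑ w, L.η w * ψ w :=
  Finset.sum_le_sum fun w _ => mul_le_mul_of_nonneg_left (h w) (L.η_nonneg w)

theorem channelMean_const (x : ℝ) : ∑ w, L.η w * x = x := by
  rw [← Finset.sum_mul, L.η_sum, one_mul]

/-- The dynamic programming operator acting on marginal costs. -/
noncomputable def marginalStep (L : WirelessLink) (c : Fin L.W → ℝ) (r d : ℕ → ℝ) : ℕ → ℝ
  | 0 => 0
  | q + 1 => r (q + 1) +
    L.arrivalMean (fun t => ∑ w, L.η w * max (d t) (min (c w) (d (t + 1)))) q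

theorem marginalStep_mono {c : Fin L.W → ℝ} {r d d' : ℕ → ℝ} (h : ∀ t, d t ≤ d' t) (q : ℕ) :
    L.marginalStep c r d q ≤ L.marginalStep c r d' q := by
  cases q with
  | zero => exact le_rfl
  | succ q =>
    exact add_le_add le_rfl (arrivalMean_mono (fun t => channelMean_mono fun w =>
      max_le_max (h _) (min_le_min le_rfl (h _))) q)

theorem marginalStep_monotone {c : Fin L.W → ℝ} {r d : ℕ → ℝ} (hr : Monotone r)
    (hr0 : ∀ q, 0 ≤ r q) (hd : Monotone d) (h0 : ∀ t, 0 ≤ d t) :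
    Monotone (L.marginalStep c r d) := by
  refine monotone_nat_of_le_succ fun q => ?_
  cases q with
  | zero =>
    refine add_nonneg (hr0 _) ?_
    rw [← arrivalMean_const (L := L) 0 0]
    refine arrivalMean_mono (fun t => ?_) 0
    exact Finset.sum_nonneg fun w _ => mul_nonneg (L.η_nonneg w) (le_max_of_le_left (h0 t))
  | succ q =>
    refine add_le_add (hr (Nat.le_succ _)) ?_
    refine Finset.sum_le_sum fun m _ => mul_le_mul_of_nonneg_left ?_ (L.θ_nonneg m)
    exact channelMean_mono fun w =>
      max_le_max (hd (by omega)) (min_le_min le_rfl (hd (by omega)))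

/-- Value iteration from `0` increases in `n`, and stays below a linear bound; the pointwise
supremum is a fixed point because each step involves finite sums of continuous functions. -/
theorem exists_isMarginalCost (hrate : L.arrivalRate < 1) {c : Fin L.W → ℝ} {Λ R : ℝ}
    (hc : ∀ w, c w ≤ Λ) (hΛ : 0 ≤ Λ) {r : ℕ → ℝ} (hr : Monotone r) (hr0 : ∀ q, 0 ≤ r q)
    (hR : ∀ q, r q ≤ R) : ∃ d, L.IsMarginalCost c r d := by
  have hR0 : 0 ≤ R := (hr0 0).trans (hR 0)
  have hρ : 0 < 1 - L.arrivalRate := by linarith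
  -- `C` solves `R + C * arrivalRate = C`, exactly what makes `C * (1 + t) + Λ` stable under the
  -- iteration.
  set C := R / (1 - L.arrivalRate) with hC
  have hC0 : 0 ≤ C := div_nonneg hR0 hρ.le
  have hCR : C * (1 - L.arrivalRate) = R := div_mul_cancel₀ _ hρ.ne'
  set T := L.marginalStep c r with hT
  set D : ℕ → ℕ → ℝ := fun n => T^[n] 0 with hD
  have hDs : ∀ n, D (n + 1) = T (D n) := fun n => Function.iterate_succ_apply' _ _ _
  have hD0 : ∀ t, D 0 t = 0 := fun t => rfl
  have hprop : ∀ n, Monotone (D n) ∧ (∀ t, 0 ≤ D n t) ∧ ∀ t : ℕ, D n t ≤ C * (1 + t) + Λ := by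
    intro n
    induction n with
    | zero =>
      refine ⟨fun _ _ _ => le_rfl, fun _ => le_rfl, fun t => ?_⟩
      rw [hD0]
      positivity
    | succ n ih =>
      obtain ⟨h1, h2, h3⟩ := ih
      have hm : Monotone (D (n + 1)) := by
        rw [hDs]; exact marginalStep_monotone hr hr0 h1 h2
      have hz : D (n + 1) 0 = 0 := by rw [hDs]; rfl
      refine ⟨hm, fun t => hz ▸ hm (Nat.zero_le t), fun t => ?_⟩
      cases t with
      | zero => rw [hz]; positivity
      | succ q =>
        rw [hDs]
        calc T (D n) (q + 1) ≤ R + L.arrivalMean (fun t => (C + Λ) + C * t) q := by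
              refine add_le_add (hR _) (arrivalMean_mono (fun t => ?_) q)
              rw [← channelMean_const (L := L) ((C + Λ) + C * t)]
              refine channelMean_mono fun w => max_le ?_ ?_
              · linarith [h3 t]
              -- Bounding the minimum by `c w` rather than by `d (t + 1)` avoids an extra `C` at
              -- each iteration.
              · refine (min_le_left _ _).trans ((hc w).trans ?_)
                have : 0 ≤ C * (t : ℝ) := by positivity
                linarith
          _ = R + ((C + Λ) + C * (q + L.arrivalRate)) := by
              rw [arrivalMean_add, arrivalMean_const, ← arrivalMean_natCast]
              simp only [arrivalMean, Finset.mul_sum]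
              congr 2
              exact Finset.sum_congr rfl fun m _ => by ring
          _ = _ := by rw [← hCR]; push_cast; ring
  have hmonoN : ∀ t, Monotone fun n => D n t := by
    intro t
    refine monotone_nat_of_le_succ fun n => ?_
    induction n generalizing t with
    | zero => rw [hD0]; exact (hprop 1).2.1 t
    | succ n ih => rw [hDs, hDs (n + 1)]; exact marginalStep_mono ih t
  have hlim : ∀ t, Filter.Tendsto (fun n => D n t) Filter.atTop (nhds (⨆ n, D n t)) := fun t =>
    tendsto_atTop_ciSup (hmonoN t) ⟨_, by rintro _ ⟨n, rfl⟩; exact (hprop n).2.2 t⟩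
  refine ⟨fun t => ⨆ n, D n t, ?_, fun q => ?_, fun s t hst => ?_, C + Λ, fun t => ?_⟩
  · refine tendsto_nhds_unique (hlim 0) (tendsto_const_nhds.congr fun n => ?_)
    cases n with
    | zero => rfl
    | succ n => rw [hDs]; rfl
  · refine tendsto_nhds_unique ((hlim (q + 1)).comp (Filter.tendsto_add_atTop_nat 1)) ?_
    have h1 : Filter.Tendsto (fun n => r (q + 1) + L.arrivalMean (fun t =>
        ∑ w, L.η w * max (D n t) (min (c w) (D n (t + 1)))) q) Filter.atTop (nhds (r (q + 1) +
        L.arrivalMean (fun t => ∑ w, L.η w *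
          max (⨆ n, D n t) (min (c w) (⨆ n, D n (t + 1)))) q)) := by
      refine tendsto_const_nhds.add (tendsto_finsetSum _ fun m _ => Filter.Tendsto.const_mul _
        (tendsto_finsetSum _ fun w _ => Filter.Tendsto.const_mul _ ?_))
      exact (hlim _).max (tendsto_const_nhds.min (hlim _))
    refine h1.congr fun n => ?_
    simp only [Function.comp, hDs]
    rfl
  · exact le_of_tendsto_of_tendsto' (hlim s) (hlim t) fun n => (hprop n).1 hst
  · refine le_of_tendsto' (hlim t) fun n => ((hprop n).2.2 t).trans ?_
    have : 0 ≤ Λ * (t : ℝ) := by positivity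
    nlinarith

namespace IsMarginalCost

variable {c : Fin L.W → ℝ} {r d : ℕ → ℝ}

theorem nonneg (h : L.IsMarginalCost c r d) (t : ℕ) : 0 ≤ d t := h.zero ▸ h.mono (Nat.zero_le t)

/-- Arrivals only raise `d`, and the maximum in the recursion keeps at least `d t`. With `r ≥ 1`
this yields strict monotonicity and linear growth of `d`. -/
theorem add_le_succ (h : L.IsMarginalCost c r d) (q : ℕ) : r (q + 1) + d q ≤ d (q + 1) := by
  rw [h.succ q]
  refine add_le_add le_rfl ?_
  rw [← arrivalMean_const (L := L) (d q) q]
  refine Finset.sum_le_sum fun m _ => mul_le_mul_of_nonneg_left ?_ (L.θ_nonneg m)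
  rw [← channelMean_const (L := L) (d q)]
  exact channelMean_mono fun w => le_max_of_le_left (h.mono (by omega))

/-- Minimal cost of an arrival slot with an empty queue, relative to the potential
`∑ j < q, d (j + 1)`. -/
noncomputable def gain (L : WirelessLink) (c : Fin L.W → ℝ) (d : ℕ → ℝ) : ℝ :=
  L.arrivalMean (fun t => (∑ j ∈ Finset.range t, d (j + 1)) -
    ∑ w, L.η w * max 0 (d t - c w)) 0

/-- The optimal continuation from `t` in state `w` is `h t - max 0 (d t - c w)`. Its increment from
`t` to `t + 1` is the middle one of `d t`, `c w`, `d (t + 1)`, because `d` is monotone; so the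
recursion for `d` is the Bellman equation differenced in `q`, and induction sums it up again. -/
theorem bellman (hd : L.IsMarginalCost c r d) {h : ℕ → ℝ}
    (hh : ∀ t, h t = ∑ j ∈ Finset.range t, d (j + 1)) (q : ℕ) :
    L.arrivalMean h q - h q = gain L c d - ∑ j ∈ Finset.range q, r (j + 1) +
      L.arrivalMean (fun t => ∑ w, L.η w * max 0 (d t - c w)) q := by
  set e : ℕ → ℝ := fun t => ∑ w, L.η w * max 0 (d t - c w) with he
  have key : ∀ q, L.arrivalMean (fun t => h t - e t) q =
      gain L c d + h q - ∑ j ∈ Finset.range q, r (j + 1) := by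
    intro q
    induction q with
    | zero => simp [gain, hh, he]
    | succ q ih =>
      have h1 : L.arrivalMean (fun t => h t - e t) (q + 1) - L.arrivalMean (fun t => h t - e t) q =
          L.arrivalMean (fun t => ∑ w, L.η w * max (d t) (min (c w) (d (t + 1)))) q := by
        simp only [arrivalMean, ← Finset.sum_sub_distrib, ← mul_sub]
        refine Finset.sum_congr rfl fun m _ => ?_
        congr 1
        rw [show q + 1 + m = q + m + 1 by ring]
        have h2 : h (q + m + 1) = h (q + m) + ∑ w, L.η w * d (q + m + 1) := by
          rw [channelMean_const, hh, hh, Finset.sum_range_succ]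
        have h3 : ∑ w, L.η w * max (d (q + m)) (min (c w) (d (q + m + 1))) =
            ∑ w, L.η w * d (q + m + 1) + e (q + m) - e (q + m + 1) := by
          simp only [he, ← Finset.sum_add_distrib, ← Finset.sum_sub_distrib]
          refine Finset.sum_congr rfl fun w _ => ?_
          have h4 : d (q + m) ≤ d (q + m + 1) := hd.mono (by omega)
          rw [← mul_add, ← mul_sub]
          congr 1
          rcases le_total (c w) (d (q + m)) with h5 | h5
          · rw [min_eq_left (h5.trans h4), max_eq_left h5, max_eq_right (sub_nonneg.2 h5),
              max_eq_right (sub_nonneg.2 (h5.trans h4))]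
            ring
          · rw [max_eq_right (le_min h5 h4), max_eq_left (sub_nonpos.2 h5)]
            rcases le_total (c w) (d (q + m + 1)) with h6 | h6
            · rw [min_eq_left h6, max_eq_right (sub_nonneg.2 h6)]
              ring
            · rw [min_eq_right h6, max_eq_left (sub_nonpos.2 h6)]
              ring
        rw [h2, h3]
        ring
      have h3 := hd.succ q
      rw [Finset.sum_range_succ]
      have h4 : h (q + 1) = h q + d (q + 1) := by rw [hh, hh, Finset.sum_range_succ]
      linarith
  have := key q
  rw [arrivalMean_sub] at this
  linarith

end IsMarginalCost

/-! ### The Lagrangian as gain plus mean loss. -/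

theorem exists_pos_arrival (hrate : 0 < L.arrivalRate) : ∃ m, 1 ≤ m ∧ 0 < L.θ m := by
  by_contra! hcon
  refine hrate.ne' (Finset.sum_eq_zero fun m _ => ?_)
  rcases Nat.eq_zero_or_pos m with rfl | hm
  · simp
  · rw [le_antisymm (hcon m hm) (L.θ_nonneg m), mul_zero]

theorem IsAdmissible.lt_of_pos (hrate : 0 < L.arrivalRate) {K : ℕ∞} {f : ℕ → Fin L.W → ℝ}
    {π : ℕ → ℝ} (ha : L.IsAdmissible K f π) {k : ℕ} (hk : 0 < π k) : (k : ℕ∞) < K := by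
  obtain ⟨m, hm, hm'⟩ := exists_pos_arrival hrate
  refine lt_of_lt_of_le ?_ (ha.noOverflow k m hk hm')
  exact_mod_cast (by omega : k < k + m)

/-- The Lagrangian of an admissible pair exceeds the optimal gain by the mean loss of its
actions. -/
theorem IsAdmissible.hasSum_loss (hrate : 0 < L.arrivalRate) {K : ℕ∞} {f : ℕ → Fin L.W → ℝ}
    {π : ℕ → ℝ} (ha : L.IsAdmissible K f π) {lam : ℝ} (hlam : 0 ≤ lam) {r d : ℕ → ℝ}
    (hd : L.IsMarginalCost (fun w => lam * L.P w) r d)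
    (hr : ∀ q : ℕ, (q : ℕ∞) < K → r q = 1) :
    HasSum (fun t => L.postArrival π t * ∑ w, L.η w *
        (max 0 (d t - lam * L.P w) - f t w * (d t - lam * L.P w)))
      (∑' k : ℕ, (k : ℝ) * π k + lam * L.power f π -
        IsMarginalCost.gain L (fun w => lam * L.P w) d) := by
  have hst := ha.stationary
  have hnn := hst.nonneg
  obtain ⟨B, hB⟩ := hd.bound
  set h : ℕ → ℝ := fun t => ∑ j ∈ Finset.range t, d (j + 1) with hh
  set e : ℕ → ℝ := fun t => ∑ w, L.η w * max 0 (d t - lam * L.P w) with he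
  obtain ⟨s1, s2, e1⟩ := ha.tsum_drift hd.nonneg hB (h := h) fun _ => rfl
  obtain ⟨e2, s3⟩ := power_eq ha.policy hnn hst.sum_one.summable
  have hebd : ∀ t : ℕ, |e t| ≤ B * (1 + t) := by
    intro t
    rw [abs_of_nonneg (Finset.sum_nonneg fun w _ =>
      mul_nonneg (L.η_nonneg w) (le_max_left _ _))]
    refine le_trans ?_ (hB t)
    refine (channelMean_mono fun w => max_le (hd.nonneg t)
      (sub_le_self _ (mul_nonneg hlam (L.P_pos w).le))).trans (channelMean_const _).le
  obtain ⟨h3, s4⟩ := hasSum_postArrival_mul (L := L) (summable_mul_shift_of_le hnn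
    hst.sum_one.summable ha.finite_delay hebd)
  have h4 : ∀ k, π k * (L.arrivalMean h k - h k) =
      IsMarginalCost.gain L (fun w => lam * L.P w) d * π k - k * π k +
        π k * L.arrivalMean e k := by
    intro k
    rcases (hnn k).eq_or_lt with h0 | h0
    · simp [← h0]
    -- Occupied lengths lie strictly below `K`, so the values of `r` from `K` on are never charged.
    · have h5 : ∑ j ∈ Finset.range k, r (j + 1) = k := by
        rw [Finset.sum_congr rfl fun j hj => hr (j + 1) (lt_of_le_of_lt
          (by exact_mod_cast Finset.mem_range.1 hj) (ha.lt_of_pos hrate h0))]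
        simp
      rw [hd.bellman (fun _ => rfl), h5]
      ring
  have h5 := ((hst.sum_one.mul_left (IsMarginalCost.gain L (fun w => lam * L.P w) d)).sub
    ha.finite_delay.hasSum).add h3
  simp only [← h4] at h5
  have h6 := h5.tsum_eq
  rw [e1] at h6
  have h7 := (s4.hasSum.sub s2.hasSum).add (s3.hasSum.mul_left lam)
  rw [← e2, h6] at h7
  have h8 : ∀ x y z : ℝ, x - (y * 1 - z + x) + lam * L.power f π =
      z + lam * L.power f π - y := fun x y z => by ring
  rw [h8] at h7
  refine h7.congr_fun fun t => ?_
  rw [mul_left_comm lam, ← mul_sub, ← mul_add]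
  congr 1
  simp only [he, sendProb, Finset.sum_mul, Finset.mul_sum, ← Finset.sum_sub_distrib,
    ← Finset.sum_add_distrib]
  exact Finset.sum_congr rfl fun w _ => by ring

theorem loss_nonneg {x a : ℝ} (h0 : 0 ≤ a) (h1 : a ≤ 1) : 0 ≤ max 0 x - a * x := by
  rcases le_total 0 x with h | h
  · rw [max_eq_right h]; nlinarith
  · rw [max_eq_left h]; nlinarith

/-! ### Existence of steady states from a drift condition. -/

theorem step_nonneg {f : ℕ → Fin L.W → ℝ} (hf : L.IsPolicy f) {π : ℕ → ℝ} (hπ : ∀ k, 0 ≤ π k)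
    (l : ℕ) : 0 ≤ L.step f π l :=
  add_nonneg (mul_nonneg (postArrival_nonneg hπ _) (sendProb_nonneg hf _))
    (mul_nonneg (postArrival_nonneg hπ _) (sub_nonneg.2 (sendProb_le_one hf _)))

theorem summable_mul_of_eventually_zero {π : ℕ → ℝ} (h : ∃ N, ∀ k, N ≤ k → π k = 0) (φ : ℕ → ℝ) :
    Summable fun k => π k * φ k := by
  obtain ⟨N, hN⟩ := h
  refine summable_of_ne_finset_zero (s := Finset.range N) fun k hk => ?_
  rw [hN k (by simpa using hk), zero_mul]

theorem postArrival_eventually_zero {π : ℕ → ℝ} (h : ∃ N, ∀ k, N ≤ k → π k = 0) :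
    ∃ N, ∀ t, N ≤ t → L.postArrival π t = 0 := by
  obtain ⟨N, hN⟩ := h
  refine ⟨N + L.M + 1, fun t ht => Finset.sum_eq_zero fun k hk => ?_⟩
  by_cases hk : N ≤ k
  · rw [hN k hk, zero_mul]
  · rw [L.θ_bounded _ (by omega), mul_zero]

theorem step_eventually_zero (f : ℕ → Fin L.W → ℝ) {π : ℕ → ℝ}
    (h : ∃ N, ∀ k, N ≤ k → π k = 0) : ∃ N, ∀ l, N ≤ l → L.step f π l = 0 := by
  obtain ⟨N, hN⟩ := postArrival_eventually_zero (L := L) h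
  refine ⟨N, fun l hl => ?_⟩
  rw [step, hN l hl, hN (l + 1) (by omega)]
  ring

/-- Duality between evolving the law and evolving the test function. Laws started from a point keep
finite support, so `φ` needs no growth condition. -/
theorem tsum_step_mul {f : ℕ → Fin L.W → ℝ} (hf : L.IsPolicy f) {π : ℕ → ℝ}
    (h : ∃ N, ∀ k, N ≤ k → π k = 0) (φ : ℕ → ℝ) :
    ∑' l, L.step f π l * φ l = ∑' k, π k *
      L.arrivalMean (fun t => L.sendProb f t * φ (t - 1) + (1 - L.sendProb f t) * φ t) k := by
  have hs := summable_mul_of_eventually_zero (postArrival_eventually_zero (L := L) h)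
  have h1 := hasSum_postArrival_mul (L := L)
    (φ := fun t => L.sendProb f t * φ (t - 1) + (1 - L.sendProb f t) * φ t)
    fun m => summable_mul_of_eventually_zero h fun k =>
      L.sendProb f (k + m) * φ (k + m - 1) + (1 - L.sendProb f (k + m)) * φ (k + m)
  rw [h1.1.tsum_eq]
  have s1 := hs fun t => L.sendProb f t * φ (t - 1)
  have s2 := hs fun t => (1 - L.sendProb f t) * φ t
  have h2 : ∑' t, L.postArrival π t * (L.sendProb f t * φ (t - 1) + (1 - L.sendProb f t) * φ t) =
      ∑' t, L.postArrival π t * (L.sendProb f t * φ (t - 1)) +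
        ∑' t, L.postArrival π t * ((1 - L.sendProb f t) * φ t) := by
    rw [← s1.tsum_add s2]
    exact tsum_congr fun t => by ring
  rw [h2, s1.tsum_eq_zero_add, sendProb_zero hf, zero_mul, mul_zero, zero_add,
    ← ((summable_nat_add_iff 1).2 s1).tsum_add s2]
  refine tsum_congr fun l => ?_
  rw [step, Nat.add_sub_cancel]
  ring

theorem step_sum_mul (f : ℕ → Fin L.W → ℝ) (p : ℕ → ℕ → ℝ) (s : Finset ℕ) (a : ℝ) (l : ℕ) :
    L.step f (fun k => a * ∑ n ∈ s, p n k) l = a * ∑ n ∈ s, L.step f (p n) l := by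
  have h : ∀ t, L.postArrival (fun k => a * ∑ n ∈ s, p n k) t =
      a * ∑ n ∈ s, L.postArrival (p n) t := by
    intro t
    simp only [postArrival]
    rw [Finset.sum_comm, Finset.mul_sum]
    refine Finset.sum_congr rfl fun k _ => ?_
    rw [mul_assoc, Finset.sum_mul]
  simp only [step, h, Finset.sum_add_distrib, ← Finset.sum_mul]
  ring

/-- A policy with a Foster–Lyapunov function has a stationary distribution with finite mean,
carried by any invariant set that contains the empty queue. -/
theorem exists_isStationary_of_drift {f : ℕ → Fin L.W → ℝ} (hf : L.IsPolicy f) {h : ℕ → ℝ}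
    (h0 : ∀ k, 0 ≤ h k) (hz : h 0 = 0) {g : ℝ}
    (hdrift : ∀ k : ℕ, L.arrivalMean
      (fun t => L.sendProb f t * h (t - 1) + (1 - L.sendProb f t) * h t) k ≤ h k + g - k)
    {A : ℕ → Prop} (hA0 : A 0) (hA : ∀ π : ℕ → ℝ, (∀ k, ¬ A k → π k = 0) →
      ∀ l, ¬ A l → L.step f π l = 0) :
    ∃ π, L.IsStationary f π ∧ (Summable fun k : ℕ => (k : ℝ) * π k) ∧ ∀ k, ¬ A k → π k = 0 := by
  set p : ℕ → ℕ → ℝ := fun n => (L.step f)^[n] (fun k => if k = 0 then 1 else 0) with hp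
  have hps : ∀ n, p (n + 1) = L.step f (p n) := fun n => Function.iterate_succ_apply' _ _ _
  have hp0 : p 0 = fun k => if k = 0 then 1 else 0 := rfl
  have hnn : ∀ n k, 0 ≤ p n k := by
    intro n
    induction n with
    | zero => intro k; rw [hp0]; dsimp only; split_ifs <;> norm_num
    | succ n ih => rw [hps]; exact step_nonneg hf ih
  have hfin : ∀ n, ∃ N, ∀ k, N ≤ k → p n k = 0 := by
    intro n
    induction n with
    | zero => exact ⟨1, fun k hk => by rw [hp0]; exact if_neg (by omega)⟩
    | succ n ih => rw [hps]; exact step_eventually_zero f ih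
  have hpA : ∀ n k, ¬ A k → p n k = 0 := by
    intro n
    induction n with
    | zero => intro k hk; rw [hp0]; exact if_neg (by rintro rfl; exact hk hA0)
    | succ n ih => rw [hps]; exact hA _ ih
  have hsm := fun n => summable_mul_of_eventually_zero (hfin n)
  have hmass : ∀ n, ∑' k, p n k = 1 := by
    intro n
    induction n with
    | zero => rw [hp0]; exact tsum_ite_eq 0 _
    | succ n ih =>
      have := tsum_step_mul hf (hfin n) fun _ => 1
      simp only [mul_one, add_sub_cancel, arrivalMean_const] at this
      rw [hps, this, ih]
  have hsm1 : ∀ n, Summable (p n) := fun n => by simpa using hsm n fun _ => 1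
  have hpot : ∀ n, ∑' k, p (n + 1) k * h k ≤ ∑' k, p n k * h k + g - ∑' k, p n k * (k : ℝ) := by
    intro n
    rw [hps, tsum_step_mul hf (hfin n)]
    have h1 : ∑' k, p n k * h k + g - ∑' k, p n k * (k : ℝ) =
        ∑' k, p n k * (h k + g - k) := by
      have : g = ∑' k, p n k * g := by rw [tsum_mul_right, hmass, one_mul]
      conv_lhs => rw [this]
      rw [← (hsm n h).tsum_add (hsm n _), ← ((hsm n h).add (hsm n _)).tsum_sub (hsm n _)]
      exact tsum_congr fun k => by ring
    rw [h1]
    exact (hsm n _).tsum_le_tsum (fun k => mul_le_mul_of_nonneg_left (hdrift k) (hnn n k)) (hsm n _)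
  -- The drift inequality telescopes; the initial potential is `h 0 = 0` and the final one is
  -- nonnegative.
  have hmean : ∀ N, ∑ n ∈ Finset.range N, ∑' k, p n k * (k : ℝ) ≤ N * g := by
    intro N
    have h1 : ∑ n ∈ Finset.range N, ∑' k, p n k * (k : ℝ) + ∑' k, p N k * h k ≤ N * g := by
      induction N with
      | zero =>
        have : ∑' k, p 0 k * h k = 0 := by
          rw [tsum_congr (g := fun _ => (0 : ℝ)), tsum_zero]
          intro k
          rw [hp0]
          dsimp only
          split_ifs with hk
          · rw [hk, hz, mul_zero]
          · rw [zero_mul]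
        simp [this]
      | succ N ih =>
        rw [Finset.sum_range_succ]
        push_cast
        linarith [hpot N]
    have h2 : 0 ≤ ∑' k, p N k * h k := tsum_nonneg fun k => mul_nonneg (hnn N k) (h0 k)
    linarith
  -- Krylov–Bogoliubov: time averages of the laws started empty have mean at most `g`, hence are
  -- tight by Markov's inequality.
  set μ : ℕ → ℕ → ℝ := fun N k => (N + 1 : ℝ)⁻¹ * ∑ n ∈ Finset.range (N + 1), p n k with hμ
  have hN : ∀ N : ℕ, (0 : ℝ) < (N + 1 : ℝ)⁻¹ := fun N => by positivity
  have havg : ∀ (N : ℕ) (s : Finset ℕ) (φ : ℕ → ℝ), ∑ k ∈ s, μ N k * φ k =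
      (N + 1 : ℝ)⁻¹ * ∑ n ∈ Finset.range (N + 1), ∑ k ∈ s, p n k * φ k := by
    intro N s φ
    rw [Finset.sum_comm, Finset.mul_sum]
    refine Finset.sum_congr rfl fun k _ => ?_
    simp only [hμ]
    rw [mul_assoc, Finset.sum_mul]
  have hcst : ∀ (N : ℕ) (x : ℝ), (N + 1 : ℝ)⁻¹ * ((N + 1 : ℕ) * x) = x := by
    intro N x
    push_cast
    field_simp
  have hμ0 : ∀ N k, 0 ≤ μ N k := fun N k =>
    mul_nonneg (hN N).le (Finset.sum_nonneg fun n _ => hnn n k)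
  have hμ1 : ∀ N (s : Finset ℕ), ∑ k ∈ s, μ N k ≤ 1 := by
    intro N s
    have h1 := havg N s fun _ => 1
    simp only [mul_one] at h1
    rw [h1]
    refine le_of_le_of_eq ?_ (hcst N 1)
    refine mul_le_mul_of_nonneg_left ?_ (hN N).le
    calc _ ≤ ∑ n ∈ Finset.range (N + 1), (1 : ℝ) := Finset.sum_le_sum fun n _ =>
          hmass n ▸ (hsm1 n).sum_le_tsum s fun k _ => hnn n k
      _ = _ := by simp
  have hμmean : ∀ N (s : Finset ℕ), ∑ k ∈ s, μ N k * (k : ℝ) ≤ g := by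
    intro N s
    rw [havg]
    refine le_of_le_of_eq ?_ (hcst N g)
    refine mul_le_mul_of_nonneg_left ?_ (hN N).le
    exact (Finset.sum_le_sum fun n _ => (hsm n fun k => (k : ℝ)).sum_le_tsum s
      fun k _ => mul_nonneg (hnn n k) k.cast_nonneg).trans (hmean (N + 1))
  have hμtight : ∀ N m : ℕ, 1 - g / (m + 1) ≤ ∑ k ∈ Finset.range (m + 1), μ N k := by
    intro N m
    have hm : (0 : ℝ) < m + 1 := by positivity
    have h1 : ∀ n, 1 - (∑' k, p n k * (k : ℝ)) / (m + 1) ≤ ∑ k ∈ Finset.range (m + 1), p n k := by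
      intro n
      have h2 := (hsm1 n).sum_add_tsum_nat_add (m + 1)
      rw [hmass] at h2
      have h3 : ∑' k, p n (k + (m + 1)) ≤ (∑' k, p n k * (k : ℝ)) / (m + 1) := by
        have h4 := (hsm n fun k => (k : ℝ)).sum_add_tsum_nat_add (m + 1)
        have h5 : 0 ≤ ∑ k ∈ Finset.range (m + 1), p n k * (k : ℝ) :=
          Finset.sum_nonneg fun k _ => mul_nonneg (hnn n k) k.cast_nonneg
        rw [le_div_iff₀ hm, ← tsum_mul_right]
        have h6 : ∑' k, p n (k + (m + 1)) * ((m : ℝ) + 1) ≤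
            ∑' k, p n (k + (m + 1)) * ((k + (m + 1) : ℕ) : ℝ) := by
          refine Summable.tsum_le_tsum (fun k => mul_le_mul_of_nonneg_left ?_ (hnn _ _))
            (((summable_nat_add_iff (m + 1)).2 (hsm1 n)).mul_right _)
            ((summable_nat_add_iff (m + 1)).2 (hsm n fun k => (k : ℝ)))
          push_cast
          linarith [k.cast_nonneg (α := ℝ)]
        linarith
      linarith
    have h2 := havg N (Finset.range (m + 1)) fun _ => 1
    simp only [mul_one] at h2
    rw [h2]
    refine le_of_eq_of_le (hcst N (1 - g / (m + 1))).symm ?_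
    refine mul_le_mul_of_nonneg_left ?_ (hN N).le
    refine le_trans ?_ (Finset.sum_le_sum fun n _ => h1 n)
    rw [Finset.sum_sub_distrib, ← Finset.sum_div, mul_sub, mul_one, ← mul_div_assoc]
    have := div_le_div_of_nonneg_right (hmean (N + 1)) hm.le
    simp only [Finset.sum_const, Finset.card_range, nsmul_eq_mul, mul_one]
    linarith
  -- A limit along an ultrafilter converges at all `k` at once, in place of a diagonal subsequence.
  set U := Filter.hyperfilter ℕ with hU
  have hex : ∀ k, ∃ x, Filter.Tendsto (fun N => μ N k) U (nhds x) := by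
    intro k
    obtain ⟨x, _, hx⟩ := (isCompact_Icc (a := (0 : ℝ)) (b := 1)).ultrafilter_le_nhds
      (U.map fun N => μ N k) (by
        rw [Filter.le_principal_iff]
        have h1 : ∀ N, μ N k ∈ Set.Icc (0 : ℝ) 1 := fun N =>
          ⟨hμ0 N k, by simpa using hμ1 N {k}⟩
        exact Filter.mem_map.2 (Filter.univ_mem' h1))
    exact ⟨x, hx⟩
  choose π hπ using hex
  have hπ0 : ∀ k, 0 ≤ π k := fun k => ge_of_tendsto' (hπ k) fun N => hμ0 N k
  have hlim : ∀ (s : Finset ℕ) (φ : ℕ → ℝ), Filter.Tendsto (fun N => ∑ k ∈ s, μ N k * φ k) U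
      (nhds (∑ k ∈ s, π k * φ k)) := fun s φ =>
    tendsto_finsetSum _ fun k _ => (hπ k).mul_const _
  have hlim1 : ∀ s : Finset ℕ, Filter.Tendsto (fun N => ∑ k ∈ s, μ N k) U
      (nhds (∑ k ∈ s, π k)) := fun s => tendsto_finsetSum _ fun k _ => hπ k
  have hstep : ∀ l, L.step f π l = π l := by
    intro l
    have h1 : Filter.Tendsto (fun N => L.step f (μ N) l) U (nhds (L.step f π l)) := by
      simp only [step, postArrival]
      exact ((hlim _ _).mul_const _).add ((hlim _ _).mul_const _)
    -- Averages are invariant up to a telescoping boundary term of order `1 / (N + 1)`.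
    have h2 : ∀ N, L.step f (μ N) l - μ N l = (N + 1 : ℝ)⁻¹ * (p (N + 1) l - p 0 l) := by
      intro N
      simp only [hμ]
      rw [step_sum_mul, ← mul_sub, ← Finset.sum_sub_distrib]
      simp only [← hps]
      rw [Finset.sum_range_sub fun n => p n l]
    have hp1 : ∀ n, p n l ≤ 1 := fun n =>
      hmass n ▸ (hsm1 n).le_tsum l fun k _ => hnn n k
    have h3 : Filter.Tendsto (fun N => L.step f (μ N) l - μ N l) Filter.atTop (nhds 0) := by
      refine squeeze_zero_norm (fun N => ?_)
        (tendsto_one_div_add_atTop_nhds_zero_nat (𝕜 := ℝ))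
      rw [h2, Real.norm_eq_abs, abs_mul, abs_of_pos (hN N), one_div]
      refine mul_le_of_le_one_right (hN N).le (abs_le.2 ⟨?_, ?_⟩)
      · linarith [hp1 0, hnn (N + 1) l]
      · linarith [hp1 (N + 1), hnn 0 l]
    have h4 := tendsto_nhds_unique (h1.sub (hπ l)) (h3.mono_left Nat.hyperfilter_le_atTop)
    linarith
  have hsum : HasSum π 1 := by
    rw [hasSum_iff_tendsto_nat_of_nonneg hπ0, ← Filter.tendsto_add_atTop_iff_nat 1]
    refine tendsto_of_tendsto_of_tendsto_of_le_of_le (g := fun m : ℕ => 1 - g / ((m : ℝ) + 1))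
      (h := fun _ => 1) ?_ tendsto_const_nhds (fun m => ?_) (fun m => ?_)
    · have := (tendsto_one_div_add_atTop_nhds_zero_nat (𝕜 := ℝ)).const_mul g
      simpa [div_eq_mul_inv] using this.const_sub 1
    · exact ge_of_tendsto' (hlim1 _) fun N => hμtight N m
    · exact le_of_tendsto' (hlim1 _) fun N => hμ1 N _
  refine ⟨π, ⟨hπ0, hsum, fun l => ?_⟩, ?_, fun k hk => ?_⟩
  · have := hasSum_transition hf π l
    rwa [hstep] at this
  · refine summable_of_sum_le (fun k => mul_nonneg k.cast_nonneg (hπ0 k)) (c := g) fun s => ?_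
    simp only [mul_comm _ (π _)]
    exact le_of_tendsto' (hlim s _) fun N => hμmean N s
  · refine tendsto_nhds_unique (hπ k) (tendsto_const_nhds.congr fun N => ?_)
    simp only [hμ]
    rw [Finset.sum_eq_zero fun n _ => hpA n k hk, mul_zero]

/-! ### Finite buffers and flow balance. -/

theorem exists_pos_of_hasSum_one {π : ℕ → ℝ} (h0 : ∀ k, 0 ≤ π k) (h : HasSum π 1) :
    ∃ k, 0 < π k := by
  by_contra! hcon
  have : π = fun _ => 0 := funext fun k => le_antisymm (hcon k) (h0 k)
  rw [this] at h
  exact zero_ne_one (hasSum_zero.unique h)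

theorem postArrival_pos {π : ℕ → ℝ} (hπ : ∀ k, 0 ≤ π k) {k m : ℕ} (hk : 0 < π k)
    (hm : 0 < L.θ m) : 0 < L.postArrival π (k + m) := by
  refine Finset.sum_pos' (fun j _ => mul_nonneg (hπ j) (L.θ_nonneg _))
    ⟨k, Finset.mem_range.2 (by omega), ?_⟩
  rw [Nat.add_sub_cancel_left]
  exact mul_pos hk hm

/-- A finite buffer can be operated without overflow only if the arrivals are Bernoulli. -/
theorem IsAdmissible.arrival_eq_zero (hrate : 0 < L.arrivalRate) {K : ℕ∞} (hK : K ≠ ⊤)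
    {f : ℕ → Fin L.W → ℝ} {π : ℕ → ℝ} (ha : L.IsAdmissible K f π) {m : ℕ} (hm : 2 ≤ m) :
    L.θ m = 0 := by
  by_contra hne
  have hθ : 0 < L.θ m := lt_of_le_of_ne (L.θ_nonneg m) (Ne.symm hne)
  have hnn := ha.stationary.nonneg
  have hy := postArrival_nonneg (L := L) hnn
  have hF0 := sendProb_nonneg ha.policy
  have hF1 := fun t => sub_nonneg.2 (sendProb_le_one ha.policy t)
  -- At most one packet leaves per slot, so a batch of two or more lengthens the queue whatever the
  -- action; the support would be unbounded.
  have hnext : ∀ k, 0 < π k → ∃ k', k < k' ∧ 0 < π k' := by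
    intro k hk
    have hpos := postArrival_pos hnn hk hθ
    rcases (hF1 (k + m)).eq_or_lt with h | h
    · refine ⟨k + m - 1, by omega, ?_⟩
      rw [ha.stationary.eq_step ha.policy, step, show k + m - 1 + 1 = k + m by omega,
        show L.sendProb f (k + m) = 1 by linarith, mul_one]
      exact add_pos_of_pos_of_nonneg hpos (mul_nonneg (hy _) (hF1 _))
    · refine ⟨k + m, by omega, ?_⟩
      rw [ha.stationary.eq_step ha.policy, step]
      exact add_pos_of_nonneg_of_pos (mul_nonneg (hy _) (hF0 _)) (mul_pos hpos h)
  have hlarge : ∀ n, ∃ k, n ≤ k ∧ 0 < π k := by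
    intro n
    induction n with
    | zero =>
      obtain ⟨k, hk⟩ := exists_pos_of_hasSum_one hnn ha.stationary.sum_one
      exact ⟨k, k.zero_le, hk⟩
    | succ n ih =>
      obtain ⟨k, h1, h2⟩ := ih
      obtain ⟨k', h3, h4⟩ := hnext k h2
      exact ⟨k', by omega, h4⟩
  lift K to ℕ using hK
  obtain ⟨k, h1, h2⟩ := hlarge K
  have h3 := ha.lt_of_pos hrate h2
  rw [Nat.cast_lt] at h3
  omega

/-- Packets leave at the rate at which they arrive. -/
theorem IsAdmissible.hasSum_silent {K : ℕ∞} {f : ℕ → Fin L.W → ℝ} {π : ℕ → ℝ}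
    (ha : L.IsAdmissible K f π) :
    HasSum (fun t => L.postArrival π t * (1 - L.sendProb f t)) (1 - L.arrivalRate) := by
  have hst := ha.stationary
  -- The drift identity for the potential `h t = t` equates the arrival rate with the departure
  -- rate.
  obtain ⟨-, s2, e⟩ := ha.tsum_drift (d := fun _ => 1) (B := 1) (h := fun t => (t : ℝ))
    (fun _ => zero_le_one) (fun t => by simp) (fun t => by simp)
  obtain ⟨h1, s1⟩ := hasSum_postArrival_mul (L := L) (π := π) (φ := fun _ => 1)
    fun m => by simpa using hst.sum_one.summable
  simp only [arrivalMean_const, mul_one] at h1 s1 s2 e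
  have h2 : ∑' k, π k * (L.arrivalMean (fun t => (t : ℝ)) k - k) = L.arrivalRate := by
    have := (hst.sum_one.mul_right L.arrivalRate).tsum_eq
    rw [one_mul] at this
    rw [← this]
    refine tsum_congr fun k => ?_
    rw [arrivalMean_natCast, add_sub_cancel_left]
  have h3 := s1.hasSum.sub s2.hasSum
  rw [← e, h2, ← hst.sum_one.unique h1] at h3
  exact h3.congr_fun fun t => by ring

theorem eq_zero_of_hasSum_nonpos {g : ℕ → ℝ} (h0 : ∀ t, 0 ≤ g t) {s : ℝ} (h : HasSum g s)
    (hs : s ≤ 0) (t : ℕ) : g t = 0 :=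
  le_antisymm ((le_hasSum h t fun j _ => h0 j).trans hs) (h0 t)

theorem eq_zero_of_channelMean_eq_zero {φ : Fin L.W → ℝ} (h0 : ∀ w, 0 ≤ φ w)
    (h : ∑ w, L.η w * φ w = 0) {w : Fin L.W} (hw : 0 < L.η w) : φ w = 0 := by
  have := (Finset.sum_eq_zero_iff_of_nonneg fun w _ => mul_nonneg (L.η_nonneg w) (h0 w)).1 h w
    (Finset.mem_univ w)
  exact (mul_eq_zero.1 this).resolve_left hw.ne'

/-! ### The greedy policy and its steady state. -/

/-- The policy that transmits as soon as the marginal cost of the last packet reaches the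
transmission cost. -/
noncomputable def greedy (L : WirelessLink) (c : Fin L.W → ℝ) (d : ℕ → ℝ) (t : ℕ)
    (w : Fin L.W) : ℝ :=
  open Classical in if t ≠ 0 ∧ c w ≤ d t then 1 else 0

theorem isPolicy_greedy (c : Fin L.W → ℝ) (d : ℕ → ℝ) : L.IsPolicy (L.greedy c d) := by
  refine ⟨fun t w => ?_, fun t w => ?_, fun w => by simp [greedy]⟩ <;>
  · unfold greedy
    split_ifs <;> norm_num

theorem loss_greedy {c : Fin L.W → ℝ} {d : ℕ → ℝ} (hc : ∀ w, 0 ≤ c w) (hd : d 0 = 0) (t : ℕ)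
    (w : Fin L.W) : max 0 (d t - c w) - L.greedy c d t w * (d t - c w) = 0 := by
  unfold greedy
  split_ifs with h
  · rw [max_eq_right (sub_nonneg.2 h.2)]
    ring
  · rw [max_eq_left]
    · ring
    · rw [not_and_or, not_not, not_le] at h
      rcases h with rfl | h
      · rw [hd]
        linarith [hc w]
      · linarith

/-- The greedy policy has an admissible steady state. -/
theorem exists_isAdmissible_greedy (hrate : 0 < L.arrivalRate) {K : ℕ∞}
    {f₀ : ℕ → Fin L.W → ℝ} {π₀ : ℕ → ℝ} (h₀ : L.IsAdmissible K f₀ π₀) {c : Fin L.W → ℝ}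
    (hc : ∀ w, 0 ≤ c w) {r d : ℕ → ℝ} (hd : L.IsMarginalCost c r d) (hr : ∀ q, 1 ≤ r q)
    (hK : ∀ (q : ℕ) w, K ≤ q → c w ≤ d q) : ∃ π, L.IsAdmissible K (L.greedy c d) π := by
  have hpol := L.isPolicy_greedy c d
  have hK0 : 0 < K := by
    obtain ⟨k, hk⟩ := exists_pos_of_hasSum_one h₀.stationary.nonneg h₀.stationary.sum_one
    exact (zero_le (a := (k : ℕ∞))).trans_lt (h₀.lt_of_pos hrate hk)
  set h : ℕ → ℝ := fun t => ∑ j ∈ Finset.range t, d (j + 1) with hh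
  set e : ℕ → ℝ := fun t => ∑ w, L.η w * max 0 (d t - c w) with he
  -- The value function itself serves as Lyapunov function: dropping the nonnegative transmission
  -- cost turns the Bellman equation into a drift inequality.
  have hlow : ∀ t, L.sendProb (L.greedy c d) t * h (t - 1) +
      (1 - L.sendProb (L.greedy c d) t) * h t ≤ h t - e t := by
    intro t
    have h1 : e t ≤ L.sendProb (L.greedy c d) t * d t := by
      rw [sendProb, Finset.sum_mul]
      refine Finset.sum_le_sum fun w _ => ?_
      rw [mul_assoc]
      refine mul_le_mul_of_nonneg_left ?_ (L.η_nonneg w)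
      have h2 := loss_greedy hc hd.zero t w
      have h3 := mul_nonneg (hpol.nonneg t w) (hc w)
      linarith
    cases t with
    | zero => rw [sendProb_zero hpol, zero_mul] at h1 ⊢; linarith
    | succ t =>
      have h2 : h (t + 1) = h t + d (t + 1) := Finset.sum_range_succ _ _
      rw [Nat.add_sub_cancel, h2]
      linarith
  have hdrift : ∀ k : ℕ, L.arrivalMean (fun t => L.sendProb (L.greedy c d) t * h (t - 1) +
      (1 - L.sendProb (L.greedy c d) t) * h t) k ≤ h k + IsMarginalCost.gain L c d - k := by
    intro k
    refine (arrivalMean_mono hlow k).trans ?_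
    rw [arrivalMean_sub]
    have h4 := hd.bellman (h := h) (fun _ => rfl) k
    have h5 : (k : ℝ) ≤ ∑ j ∈ Finset.range k, r (j + 1) := by
      calc (k : ℝ) = ∑ j ∈ Finset.range k, (1 : ℝ) := by simp
        _ ≤ _ := Finset.sum_le_sum fun j _ => hr _
    linarith
  -- Lengths below `K` are closed under the dynamics: for finite `K` batches have size at most one,
  -- and a post-arrival queue of length `K` always sends.
  have hinv : ∀ π : ℕ → ℝ, (∀ k : ℕ, ¬ (k : ℕ∞) < K → π k = 0) →
      ∀ l : ℕ, ¬ (l : ℕ∞) < K → L.step (L.greedy c d) π l = 0 := by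
    intro π hπ l hl
    rw [not_lt] at hl
    have hT : K ≠ ⊤ := ne_top_of_le_ne_top (ENat.natCast_ne_top l) hl
    have hl0 : l ≠ 0 := by
      rintro rfl
      exact absurd hl (not_le.2 (by exact_mod_cast hK0))
    have h4 : L.postArrival π (l + 1) = 0 := by
      refine Finset.sum_eq_zero fun k hk => ?_
      by_cases hkK : (k : ℕ∞) < K
      · have hkl : k < l := by exact_mod_cast hkK.trans_le hl
        rw [h₀.arrival_eq_zero hrate hT (by omega), mul_zero]
      · rw [hπ k hkK, zero_mul]
    have h5 : L.sendProb (L.greedy c d) l = 1 := by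
      rw [sendProb, ← L.η_sum]
      refine Finset.sum_congr rfl fun w _ => ?_
      rw [greedy, if_pos ⟨hl0, hK l w hl⟩, mul_one]
    rw [step, h4, h5]
    ring
  have hh0 : ∀ t, 0 ≤ h t := fun t => Finset.sum_nonneg fun j _ => hd.nonneg _
  have hhz : h 0 = 0 := Finset.sum_range_zero _
  obtain ⟨π, h1, h2, h3⟩ := exists_isStationary_of_drift (h := h) (A := fun k => (k : ℕ∞) < K)
    hpol hh0 hhz hdrift (by exact_mod_cast hK0) hinv
  refine ⟨π, hpol, h1, fun k m hk hm => ?_, h2⟩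
  have hkK : (k : ℕ∞) < K := by
    by_contra hcon
    exact hk.ne' (h3 k hcon)
  by_cases hT : K = ⊤
  · rw [hT]; exact le_top
  · have hm1 : m < 2 := by
      by_contra hcon
      exact hm.ne' (h₀.arrival_eq_zero hrate hT (by omega))
    lift K to ℕ using hT
    rw [Nat.cast_lt] at hkK
    exact_mod_cast (by omega : k + m ≤ K)

end WirelessLink

/-! ### The threshold structure. -/

theorem lemma4 (L : WirelessLink) (hrate : 0 < L.arrivalRate) (K : ℕ∞) (Paver : ℝ)
    (hslack : ∃ (f₀ : ℕ → Fin L.W → ℝ) (π₀ : ℕ → ℝ),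
      L.IsAdmissible K f₀ π₀ ∧ L.power f₀ π₀ < Paver)
    (f : ℕ → Fin L.W → ℝ) (π : ℕ → ℝ) (hopt : L.IsOptimal K Paver f π) :
    ∀ w : Fin L.W, ∃ I : ℕ, (I : ℕ∞) ≤ K ∧
      ∀ t : ℕ, 0 < L.stateProb π t w →
        (t < I → f t w = 0) ∧ (I < t → f t w = 1) := by
  classical
  intro w
  have ha := hopt.admissible
  have hpol := ha.policy
  have hy := WirelessLink.postArrival_nonneg (L := L) ha.stationary.nonneg
  have hpos : ∀ t, 0 < L.stateProb π t w → 0 < L.η w ∧ 0 < L.postArrival π t := by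
    intro t ht
    have ht' : 0 < L.η w * L.postArrival π t := ht
    exact ⟨pos_of_mul_pos_left ht' (hy t), pos_of_mul_pos_right ht' (L.η_nonneg w)⟩
  rcases lt_or_ge L.arrivalRate 1 with hlt | hge
  swap
  -- The total probability of silence is `1 - arrivalRate ≤ 0`, so every state of positive
  -- probability transmits.
  · refine ⟨0, by simp, fun t ht => ⟨fun h => absurd h (Nat.not_lt_zero t), fun _ => ?_⟩⟩
    obtain ⟨h1, h2⟩ := hpos t ht
    have h3 := WirelessLink.eq_zero_of_hasSum_nonpos (fun t => mul_nonneg (hy t)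
      (sub_nonneg.2 (WirelessLink.sendProb_le_one hpol t))) ha.hasSum_silent (by linarith) t
    have h4 : ∑ w, L.η w * (1 - f t w) = 0 := by
      rw [← (mul_eq_zero.1 h3).resolve_left h2.ne']
      simp only [mul_sub, mul_one, Finset.sum_sub_distrib, L.η_sum, WirelessLink.sendProb]
    have h5 := WirelessLink.eq_zero_of_channelMean_eq_zero
      (fun w => sub_nonneg.2 (hpol.le_one t w)) h4 h1
    linarith
  obtain ⟨lam, hlam, hmin⟩ := hopt.exists_multiplier hrate hslack
  set c : Fin L.W → ℝ := fun w => lam * L.P w with hc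
  have hc0 : ∀ w, 0 ≤ c w := fun w => mul_nonneg hlam (L.P_pos w).le
  have hcle : ∀ w, c w ≤ ∑ w, c w := fun w =>
    Finset.single_le_sum (fun w _ => hc0 w) (Finset.mem_univ w)
  have hΛ : 0 ≤ ∑ w, c w := Finset.sum_nonneg fun w _ => hc0 w
  -- The surcharge exceeds every transmission cost, so `c w ≤ d q` for `q ≥ K`; this keeps the
  -- greedy policy within the buffer and the threshold at most `K`.
  set r : ℕ → ℝ := fun q => if (q : ℕ∞) < K then 1 else 1 + ∑ w, c w with hr
  have hr1 : ∀ q, 1 ≤ r q := by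
    intro q; simp only [hr]; split_ifs <;> linarith
  have hrR : ∀ q, r q ≤ 1 + ∑ w, c w := by
    intro q; simp only [hr]; split_ifs <;> linarith
  have hrmono : Monotone r := by
    intro s t hst
    by_cases h : (t : ℕ∞) < K
    · have h' : (s : ℕ∞) < K := lt_of_le_of_lt (by exact_mod_cast hst) h
      simp [hr, h, h']
    · calc r s ≤ _ := hrR s
        _ = r t := by simp [hr, h]
  obtain ⟨d, hd⟩ := WirelessLink.exists_isMarginalCost hlt hcle hΛ hrmono
    (fun q => zero_le_one.trans (hr1 q)) hrR
  have hstep : ∀ q, 1 + d q ≤ d (q + 1) := fun q => by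
    linarith [hd.add_le_succ q, hr1 (q + 1)]
  have hstrict : StrictMono d := strictMono_nat_of_lt_succ fun q => by linarith [hstep q]
  have hgrow : ∀ q : ℕ, (q : ℝ) ≤ d q := by
    intro q
    induction q with
    | zero => simp [hd.zero]
    | succ q ih => push_cast; linarith [hstep q]
  have hdK : ∀ (q : ℕ) w, 0 < q → K ≤ q → c w ≤ d q := by
    intro q w hq hKq
    obtain ⟨q, rfl⟩ := Nat.exists_eq_succ_of_ne_zero hq.ne'
    have h1 := hd.add_le_succ q
    have h2 : r (q + 1) = 1 + ∑ w, c w := if_neg (not_lt.2 hKq)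
    have h3 := hd.nonneg q
    have h4 := hcle w
    change c w ≤ d (q + 1)
    linarith
  have hK0 : 0 < K := by
    obtain ⟨k, hk⟩ := WirelessLink.exists_pos_of_hasSum_one ha.stationary.nonneg
      ha.stationary.sum_one
    exact (zero_le (a := (k : ℕ∞))).trans_lt (ha.lt_of_pos hrate hk)
  have hdK' : ∀ (q : ℕ) w, K ≤ q → c w ≤ d q := fun q w hq =>
    hdK q w (by exact_mod_cast hK0.trans_le hq) hq
  have hr' : ∀ q : ℕ, (q : ℕ∞) < K → r q = 1 := fun q hq => if_pos hq
  obtain ⟨πg, hg⟩ := WirelessLink.exists_isAdmissible_greedy hrate ha hc0 hd hr1 hdK'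
  have hgsum := hg.hasSum_loss hrate hlam hd hr'
  have hg0 : ∀ t, L.postArrival πg t * ∑ w, L.η w * (max 0 (d t - lam * L.P w) -
      L.greedy c d t w * (d t - lam * L.P w)) = 0 := by
    intro t
    rw [Finset.sum_eq_zero, mul_zero]
    intro w _
    rw [WirelessLink.loss_greedy hc0 hd.zero t w, mul_zero]
  simp only [hg0] at hgsum
  -- The Lagrangian of the greedy pair equals the gain, so the optimal pair has nonpositive, hence
  -- zero, total loss.
  have hval := hasSum_zero.unique hgsum
  have hle := hmin _ _ hg
  have hloss : ∀ t w, 0 ≤ max 0 (d t - lam * L.P w) - f t w * (d t - lam * L.P w) := fun t w =>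
    WirelessLink.loss_nonneg (hpol.nonneg t w) (hpol.le_one t w)
  have hex : ∃ I, c w ≤ d I := by
    obtain ⟨n, hn⟩ := exists_nat_ge (c w)
    exact ⟨n, hn.trans (hgrow n)⟩
  -- The threshold is the first `I` with `c w ≤ d I`. Equality may hold there, which leaves the
  -- action at `t = I` undetermined; beyond it strict monotonicity of `d` decides.
  refine ⟨Nat.find hex, ?_, fun t ht => ?_⟩
  · by_cases hT : K = ⊤
    · rw [hT]; exact le_top
    · lift K to ℕ using hT
      exact_mod_cast Nat.find_min' hex (hdK' K w le_rfl)
  obtain ⟨h1, h2⟩ := hpos t ht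
  have h3 := WirelessLink.eq_zero_of_hasSum_nonpos (fun t => mul_nonneg (hy t)
    (Finset.sum_nonneg fun w _ => mul_nonneg (L.η_nonneg w) (hloss t w)))
    (ha.hasSum_loss hrate hlam hd hr') (by linarith) t
  have h4 := WirelessLink.eq_zero_of_channelMean_eq_zero (hloss t)
    ((mul_eq_zero.1 h3).resolve_left h2.ne') h1
  constructor
  · intro hI
    have h5 : d t - lam * L.P w < 0 := sub_neg.2 (not_le.1 (Nat.find_min hex hI))
    rw [max_eq_left h5.le, zero_sub, neg_eq_zero] at h4
    exact (mul_eq_zero.1 h4).resolve_right h5.ne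
  · intro hI
    have h5 : 0 < d t - lam * L.P w :=
      sub_pos.2 ((Nat.find_spec hex).trans_lt (hstrict hI))
    rw [max_eq_right h5.le, ← one_sub_mul] at h4
    linarith [(mul_eq_zero.1 h4).resolve_right h5.ne']
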